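/- **Setting.** Let $p,q\ge 1$ and $\Delta\ge 1$ be integers, and let $\widehat P,\widehat Q$ be closed, connected, oriented surfaces containing finite graphs $G_P\subset\widehat P$, $G_Q\subset\widehat Q$ with vertices numbered $1,\dots,p$ and $1,\dots,q$ respectively and each vertex given a sign $\pm$. (The graphs need not be connected, and their faces need not be disks.) We call $(G_P,G_Q)$ a pair of *intersection graphs* if the following hold. 1. There is a one-one correspondence between the edges of $G_P$ and those of $G_Q$, and between their endpoints. An endpoint that lies at vertex $i$ of $G_P$ and at vertex $j$ of $G_Q$ is given the label $j$ in $G_P$ and the label $i$ in $G_Q$. For all $i,j$ there are exactly $\Delta$ such endpoints. 2. Around each vertex of $G_P$ the labels occur in the cyclic order $1,2,\dots,q,1,2,\dots,q,\dots$ (repeated $\Delta$ times), anticlockwise at a positive vertex and clockwise at a negative one. Likewise for $G_Q$, with the labels $1,\dots,p$. 3. (Parity rule) If an edge joins vertices $i,i'$ in $G_P$ and $j,j'$ in $G_Q$, then $i,i'$ have the same sign if and only if $j,j'$ have opposite signs. 4. Neither graph has a trivial loop, i.e. a loop that bounds a disk containing no vertex in its interior. (This is the structure carried by the arcs of $P\cap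 Q$, for surfaces $P,Q$ properly embedded in a compact orientable irreducible 3-manifold $M$ with torus boundary, where $\partial P$ consists of $p$ curves of slope $\alpha$, $\partial Q$ consists of $q$ curves of slope $\beta$, each component of $\partial P$ meets each component of $\partial Q$ in exactly $\Delta=\Delta(\alpha,\beta)$ points, every arc of $P\cap Q$ is essential in both $P$ and $Q$, and $\widehat P\subset M(\alpha)$, $\widehat Q\subset M(\beta)$ are the surfaces capped off by meridian disks, which are the vertices.) **Types.** The boundary of a disk face $D$ of $G_P$ is an alternating sequence of edges and corners, and each corner is one of the $q$ intervals $(1,2),(2,3),\dots,(q-1,q),(q,1)$ of labels. Let $[D]\in\mathbb Z^q$ be the sum of the corners of $D$, each counted with the sign of its vertex. A type is a vector $\tau\in\{\pm1\}^q$. The disk face $D$ *represents* $\tau$ if (1) for some $\eta=\pm1$ we have $\operatorname{sign}[D]_i=\eta\tau_i$ for every $i$ with $[D]_i\ne0$, (2) $\sum_i|[D]_i|\ge2$, and (3) no interval appears as a corner of $D$ at two vertices of opposite sign. $G_P$ *represents all types* if each $\tau\in\{\pm1\}^q$ is represented by some disk face of $G_P$. **Webs.** A $k$-*web* in $G_Q$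 is a non-empty subgraph $\Lambda$ of $G_Q$ all of whose vertices have the same sign, such that at most $k$ edge-endpoints of $G_Q$ at vertices of $\Lambda$ are not endpoints of edges of $\Lambda$. It is *great* if it is contained in the interior of a disk $D_\Lambda\subset\widehat Q$ such that every vertex of $G_Q$ lying in $D_\Lambda$ is a vertex of $\Lambda$. **Theorem.** Let $(G_P,G_Q)$ be a pair of intersection graphs as above. Assume that $\Delta>1-\chi(\widehat P)/p$ and that $\widehat Q\cong S^2$. Then either $G_P$ represents all types or $G_Q$ contains a great $(p-\chi(\widehat P))$-web. -/

import Mathlib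

/-- A finite graph, without isolated vertices, embedded in a closed connected oriented surface,
up to orientation preserving homeomorphism.  The graph need not be connected, and the faces (the
components of the complement of the graph) need not be disks.

`X` is the set of edge-endpoints (half-edges) and the permutation `e` of `X` exchanges the two
endpoints of each edge; the vertices are the elements of `Fin n`.  The endpoint following `x` in
the anticlockwise order around its vertex is `rot x`.  The *corner* `x` is the sector at that
vertex that one sweeps anticlockwise from `x` to `rot x`. -/
structure EmbeddedGraph {X : Type*} [Fintype X] (e : Equiv.Perm X) (n : ℕ) where
  edge_edge : ∀ x, e (e x) = x
  edge_ne : ∀ x, e x ≠ x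
  /-- the vertex at which an endpoint lies -/
  vert : X → Fin n
  vert_surjective : Function.Surjective vert
  rot : Equiv.Perm X
  /-- the endpoints at one vertex form one cycle of `rot` -/
  vert_eq_iff : ∀ x y, vert x = vert y ↔ rot.SameCycle x y
  /-- two corners are related if they lie in the same face; every face has a corner, because the
  surface is connected and there are no isolated vertices -/
  faces : Setoid X
  /-- Walking along the boundary of a face, with the face on the left: after the corner `x` one
  leaves along the edge of `x`, arrives at the endpoint `e x`, and the next corner lies between
  `rot⁻¹ (e x)` and `e x`. -/
  faces_boundary : ∀ x, faces x (rot.symm (e x))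
  /-- the genus of each face (of the compact surface obtained by cutting along the graph) -/
  genus : Quotient faces → ℕ
  /-- the surface is connected -/
  connected : ∀ x y, Relation.EqvGen (fun a b => b = rot a ∨ b = e a ∨ faces a b) x y

namespace EmbeddedGraph

variable {X : Type*} [Fintype X] {e : Equiv.Perm X} {n : ℕ} (G : EmbeddedGraph e n)

/-- The faces of the embedded graph. -/
abbrev Face : Type _ := Quotient G.faces

noncomputable instance : Fintype G.Face := Fintype.ofFinite _

/-- The face containing the corner `x`. -/
def face (x : X) : G.Face := Quotient.mk G.faces x

/-- The permutation of the corners that sends each corner to the next one on the boundary of its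
face. -/
def next : Equiv.Perm X := e.trans G.rot.symm

/-- The number of boundary circles of (the compact surface belonging to) a face: the number of
cycles of `next` on the corners of the face. -/
noncomputable def numBoundary (f : G.Face) : ℕ :=
  Set.ncard ((fun x => Quotient.mk (Equiv.Perm.SameCycle.setoid G.next) x) '' {x | G.face x = f})

/-- The Euler characteristic `2 - 2g - b` of a face. -/
noncomputable def faceChi (f : G.Face) : ℤ :=
  2 - 2 * (G.genus f : ℤ) - (G.numBoundary f : ℤ)

/-- The Euler characteristic `V - E + ∑ χ(f)` of the closed surface containing the graph. -/
noncomputable def surfaceChi : ℤ :=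
  (n : ℤ) - ((Fintype.card X / 2 : ℕ) : ℤ) + ∑ f : G.Face, G.faceChi f

/-- The closed connected orientable surface containing the graph is a 2-sphere. -/
def IsSphere : Prop := G.surfaceChi = 2

/-- A face is a disk if it has genus zero and one boundary circle. -/
def IsDisk (f : G.Face) : Prop := G.genus f = 0 ∧ G.numBoundary f = 1

/-- There is no trivial loop.  A trivial loop is a loop at a vertex that bounds, together with an
arc in the boundary of the (fat) vertex, a disk whose interior contains no vertices.  If there is
one, then there is an innermost one, and it bounds a disk face with a single corner, whose
boundary walk is the edge followed by that corner. -/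
def NoTrivialLoops : Prop := ∀ x, G.IsDisk (G.face x) → G.next x ≠ x

/-- A subgraph: a set of vertices, and a set of edges (given by their endpoints) joining them. -/
structure Subgraph where
  verts : Set (Fin n)
  ends : Set X
  edge_mem : ∀ x ∈ ends, e x ∈ ends
  vert_mem : ∀ x ∈ ends, G.vert x ∈ verts

variable {G}

/-- Two corners lie in the same component of the complement of the subgraph `Λ` in the surface:
one gets from one to the other by moving within faces of `G` and by crossing edges of `G` that
are not in `Λ` (the edge of `rot a` separates the corners `a` and `rot a`; moving through a vertex
that is not in `Λ` amounts to crossing edges at that vertex, none of which is in `Λ`). -/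
def Subgraph.SameRegion (Λ : G.Subgraph) : X → X → Prop :=
  Relation.EqvGen (fun a b => G.faces a b ∨ (b = G.rot a ∧ b ∉ Λ.ends))

/-- For a graph in a 2-sphere: the subgraph `Λ` is contained in the interior of a disk `D` in the
sphere such that each vertex of `G` lying in `D` is a vertex of `Λ`.  Equivalently, all vertices of
`G` that are not in `Λ` lie in a single component of the complement of `Λ`: the complement of `D`
is connected, disjoint from `Λ` and contains those vertices; conversely, take for `D` the
complement of a thin open neighbourhood of a tree that joins those vertices in the component (of a
point if there are none). -/
def Subgraph.IsGreat (Λ : G.Subgraph) : Prop :=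
  ∀ x y, G.vert x ∉ Λ.verts → G.vert y ∉ Λ.verts → Λ.SameRegion x y

end EmbeddedGraph

/-- An embedded graph with signed vertices and with the edge-endpoints labelled by `m` labels such
that around each vertex one sees the labels `1, 2, …, m` in this cyclic order, repeated `Δ` times,
anticlockwise at a positive vertex and clockwise at a negative vertex. -/
structure LabelledGraph {X : Type*} [Fintype X] (e : Equiv.Perm X) (n m Δ : ℕ) extends
    EmbeddedGraph e n where
  sign : Fin n → ℤˣ
  label : X → Fin m
  label_pos : ∀ x, sign (vert x) = 1 → label (rot x) = finRotate m (label x)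
  label_neg : ∀ x, sign (vert x) = -1 → label x = finRotate m (label (rot x))
  label_count : ∀ i j, Set.ncard {x | vert x = i ∧ label x = j} = Δ

namespace LabelledGraph

variable {X : Type*} [Fintype X] {e : Equiv.Perm X} {n m Δ : ℕ} (G : LabelledGraph e n m Δ)

/-- The interval `(i, i+1)` of successive labels (cyclically) that the corner `x` is; it is
recorded by `i`. -/
def interval (x : X) : Fin m :=
  if G.sign (G.vert x) = 1 then G.label x else G.label (G.rot x)

open scoped Classical in
/-- The element `[D]` of `ℤ^m`: the algebraic sum of the corners of the face `D`, each corner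
counted with the sign of its vertex. -/
noncomputable def faceVector (D : G.Face) (i : Fin m) : ℤ :=
  ∑ x : X with G.face x = D ∧ G.interval x = i, ((G.sign (G.vert x) : ℤˣ) : ℤ)

end LabelledGraph

/-- The vector `a` in `ℤ^m` represents the type `τ`. -/
def VectorRepresents {m : ℕ} (a : Fin m → ℤ) (τ : Fin m → ℤˣ) : Prop :=
  (∃ η : ℤˣ, ∀ i, a i ≠ 0 → (a i).sign = ((η * τ i : ℤˣ) : ℤ)) ∧ 2 ≤ ∑ i, |a i|

namespace LabelledGraph

variable {X : Type*} [Fintype X] {e : Equiv.Perm X} {n m Δ : ℕ} (G : LabelledGraph e n m Δ)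

/-- The disk face `D` represents the type `τ`; the last condition is the coherence condition that
no interval appears as a corner of `D` at two vertices of opposite sign. -/
def FaceRepresents (D : G.Face) (τ : Fin m → ℤˣ) : Prop :=
  G.IsDisk D ∧ VectorRepresents (G.faceVector D) τ ∧
    ∀ x y, G.face x = D → G.face y = D → G.interval x = G.interval y →
      G.sign (G.vert x) = G.sign (G.vert y)

/-- Every type is represented by some disk face. -/
def RepresentsAllTypes : Prop := ∀ τ : Fin m → ℤˣ, ∃ D : G.Face, G.FaceRepresents D τ

/-- A (non-empty) subgraph is a `k`-web if all its vertices have the same sign and at most `k`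
edge-endpoints of `G` at its vertices are not endpoints of its edges. -/
def IsWeb (k : ℤ) (Λ : G.Subgraph) : Prop :=
  Λ.verts.Nonempty ∧ (∀ v ∈ Λ.verts, ∀ w ∈ Λ.verts, G.sign v = G.sign w) ∧
    ((Set.ncard {x | G.vert x ∈ Λ.verts ∧ x ∉ Λ.ends} : ℕ) : ℤ) ≤ k

/-- A great `k`-web (in a 2-sphere). -/
def IsGreatWeb (k : ℤ) (Λ : G.Subgraph) : Prop := G.IsWeb k Λ ∧ Λ.IsGreat

end LabelledGraph

/-- A pair of labelled intersection graphs `G_P`, `G_Q` in closed connected oriented surfaces.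
The set `X` is `∂P ∩ ∂Q`, and `e` exchanges the two endpoints of each arc component of `P ∩ Q`;
thus the two graphs have the same edges and the same edge-endpoints.  The endpoint in which the
`i`-th component of `∂P` meets the `j`-th component of `∂Q` lies at the vertex `i` of `G_P`, where
it has the label `j`, and at the vertex `j` of `G_Q`, where it has the label `i`. -/
structure IntersectionGraphs {X : Type*} [Fintype X] (e : Equiv.Perm X) (p q Δ : ℕ) where
  p_pos : 0 < p
  q_pos : 0 < q
  GP : LabelledGraph e p q Δ
  GQ : LabelledGraph e q p Δ
  label_GP : GP.label = GQ.vert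
  label_GQ : GQ.label = GP.vert
  /-- the parity rule: the endpoints of an arc are intersections of opposite sign of `∂P`, `∂Q` -/
  parity : ∀ x, GP.sign (GP.vert x) = GP.sign (GP.vert (e x)) ↔
    GQ.sign (GQ.vert x) ≠ GQ.sign (GQ.vert (e x))
  noTrivialLoops_GP : GP.NoTrivialLoops
  noTrivialLoops_GQ : GQ.NoTrivialLoops

/-! Cut the surface of `G_P` along the edges with a label in a set `K` and the edges along which the
orientation relative to a type `τ` changes. A component of what remains (faces glued across uncut
edges) has Euler characteristic at most one. `NonRep K τ` says that a coherent component never has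
characteristic one. If no disk face represents `τ`, this holds for `K` the set of all labels,
because the components are then single faces (`nonRep_univ`).

The property passes to smaller `K` and other types by one index argument, `NonRep.of_levels`. A
coherent component for the new data is a union of old components, and an integer level is followed
along their boundaries. An old component on whose boundary the level never drops has constant level
along its cut sides, hence constant orientation along its boundary walks, hence characteristic at
most zero. Every other component pays for its characteristic with a drop, and an edge that becomes
internal supplies at most one drop, while gluing along it lowers the characteristic by one.

With the levels `±1` this gives derivation: replace `τ` by the type that records, between
consecutive falls, the sign of the `G_Q`-vertex of the rise there. The parity rule excludes
simultaneous drops on the two sides of an edge joining two rises. Iteration reaches a type whose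
rises share one sign and whose falls share one sign (`Persistent.exists_constant`). Summing Euler
characteristics over all components (`NonRep.card_unchanged_le`) bounds the edges leaving the falls
plus those leaving the rises by `2 (p - χ)`, so one of the two families, a set `L` of `G_Q`-vertices
of one sign, has at most `p - χ` leaving endpoints.

Let `A` be a component of the subgraph of `G_Q` induced on `L`. If every vertex enclosed by `A` has
the same sign as `A`, then `A` together with these vertices is the great web. Otherwise a
complementary component of `A` contains a vertex of the wrong sign; edges from its vertex set `J`
end in `J` or `A`, and a three-step level function (the modes) yields a type with switches in `J`
satisfying `NonRep J` (`NonRep.exists_switches_subset`). The argument is repeated inside `J`, which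
is strictly smaller. -/

/-! ### Finite sign tables for modes and levels -/

/-- The sign that belongs to a mode. -/
def modeSign (i : Fin 3) : ℤˣ := if i = 1 then -1 else 1

/-- The level of an interval of given mode and type. -/
def modeLevel (i : Fin 3) (t : ℤˣ) : ℤ := 2 * (i.val : ℤ) + (t : ℤ)

/-- The three modes occupy the levels `{-1, 1}`, `{1, 3}`, `{3, 5}`. Neighbouring modes share a
level, and there the opposite mode signs compensate the opposite type values. This is what allows
modes to be used in `NonRep.of_levels`. -/
theorem modeSign_eq_of_modeLevel_eq : ∀ (a b : Fin 3) (c d : ℤˣ), modeLevel a c = modeLevel b d →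
    c * modeSign a = d * modeSign b := by decide

theorem modeLevel_odd (a : Fin 3) (c : ℤˣ) : modeLevel a c % 2 = 1 := by
  revert a c; decide

-- The four tables compare the level at an end of an interval of modes with the middle value `2`: it
-- may lie one unit on the wrong side only if the signed label agrees with `r * s`. The hypotheses
-- are the end conditions of `IsMode`.
set_option synthInstance.maxSize 1000 in
set_option maxRecDepth 10000 in
set_option synthInstance.maxHeartbeats 200000 in
theorem modeLevel_first_pos : ∀ (a : Fin 3) (c f s r : ℤˣ), (a = 2 → f = s ∧ c = -1) →
    (a = 1 → f = s → c = 1) → modeSign a = r →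
    0 ≤ (r : ℤ) * (2 - modeLevel a c) + 1 ∧
      (1 * f ≠ r * s → 0 ≤ (r : ℤ) * (2 - modeLevel a c) - 1) := by decide

set_option synthInstance.maxSize 1000 in
set_option maxRecDepth 10000 in
set_option synthInstance.maxHeartbeats 200000 in
theorem modeLevel_first_neg : ∀ (a : Fin 3) (c f s r : ℤˣ), (a = 2 → f = s ∧ c = -1) →
    (a = 1 → f = s → c = 1) → -modeSign a = r →
    0 ≤ (r : ℤ) * (modeLevel a c - 2) + 1 ∧
      (-1 * f ≠ r * s → 0 ≤ (r : ℤ) * (modeLevel a c - 2) - 1) := by decide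

set_option synthInstance.maxSize 1000 in
set_option maxRecDepth 10000 in
set_option synthInstance.maxHeartbeats 200000 in
theorem modeLevel_last_pos : ∀ (b : Fin 3) (d f s r : ℤˣ), (b = 0 → f = s ∧ d = 1) →
    (b = 1 → f = s → d = -1) → modeSign b = r →
    0 ≤ (r : ℤ) * (modeLevel b d - 2) + 1 ∧
      (1 * f ≠ r * s → 0 ≤ (r : ℤ) * (modeLevel b d - 2) - 1) := by decide

set_option synthInstance.maxSize 1000 in
set_option maxRecDepth 10000 in
set_option synthInstance.maxHeartbeats 200000 in
theorem modeLevel_last_neg : ∀ (b : Fin 3) (d f s r : ℤˣ), (b = 0 → f = s ∧ d = 1) →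
    (b = 1 → f = s → d = -1) → -modeSign b = r →
    0 ≤ (r : ℤ) * (2 - modeLevel b d) + 1 ∧
      (-1 * f ≠ r * s → 0 ≤ (r : ℤ) * (2 - modeLevel b d) - 1) := by decide

/-- The level rises or falls along a label by at most two. -/
def LevelStep (v w : ℤ) (r f s g : ℤˣ) (A : Prop) : Prop :=
  (r : ℤ) * (v - w) ≤ 0 ∨
    ((r : ℤ) * (v - w) = 2 ∧ (v + w = 4 ∧ g * f = r * s ∨ v + w ≠ 4 ∧ A ∧ g = r))

-- Either the mode is constant at the label, and then the level moves with `τ`, or the label is a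
-- fall of sign `s`. At such a fall a step up from level `1` to `3` crosses the middle value `2`,
-- whence the alternative `v + w = 4`.
set_option synthInstance.maxSize 1000 in
set_option maxRecDepth 10000 in
set_option synthInstance.maxHeartbeats 200000 in
theorem levelStep_pos : ∀ (a b : Fin 3) (c d f s r : ℤˣ),
    (¬ ((d = 1 ∧ c = -1) ∧ f = s) → b = a) → ((d = 1 ∧ c = -1) ∧ f = s → b ≠ 1 ∧ a = 2) →
    modeSign a = r →
    LevelStep (modeLevel a c) (modeLevel b d) r f s 1 (d = -1 ∧ c = 1) := by
  unfold LevelStep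
  decide

set_option synthInstance.maxSize 1000 in
set_option maxRecDepth 10000 in
set_option synthInstance.maxHeartbeats 200000 in
theorem levelStep_neg : ∀ (a b : Fin 3) (c d f s r : ℤˣ),
    (¬ ((d = 1 ∧ c = -1) ∧ f = s) → b = a) → ((d = 1 ∧ c = -1) ∧ f = s → b ≠ 1 ∧ a = 2) →
    -modeSign b = r →
    LevelStep (modeLevel b d) (modeLevel a c) r f s (-1) (d = -1 ∧ c = 1) := by
  unfold LevelStep
  decide

section Classical

open scoped Classical

/-! ### Euler characteristics of regions -/

namespace EmbeddedGraph

variable {X : Type*} [Fintype X] {e : Equiv.Perm X} {n : ℕ} (G : EmbeddedGraph e n)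

theorem next_apply (x : X) : G.next x = G.rot.symm (e x) := rfl

theorem next_edge (x : X) : G.next (e x) = G.rot.symm x := by
  rw [next_apply, G.edge_edge]

theorem face_next (x : X) : G.face (G.next x) = G.face x :=
  (Quotient.sound (s := G.faces) (G.faces_boundary x)).symm

theorem face_edge (x : X) : G.face (e x) = G.face (G.rot.symm x) := by
  rw [← G.next_edge, G.face_next]

theorem vert_rot_symm (x : X) : G.vert (G.rot.symm x) = G.vert x := by
  rw [G.vert_eq_iff]
  exact ⟨1, by simp⟩

theorem vert_rot (x : X) : G.vert (G.rot x) = G.vert x := by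
  rw [G.vert_eq_iff]
  exact ⟨-1, by simp⟩

theorem numBoundary_pos (f : G.Face) : 0 < G.numBoundary f := by
  obtain ⟨x, rfl⟩ := Quotient.exists_rep f
  rw [numBoundary, Set.ncard_pos]
  exact ⟨_, x, rfl, rfl⟩

theorem faceChi_le_one (f : G.Face) : G.faceChi f ≤ 1 := by
  have := G.numBoundary_pos f
  rw [faceChi]
  omega

/-- The corners of the components of the complement of the set of edges `T`. -/
def region (T : X → Prop) : Setoid X :=
  Relation.EqvGen.setoid (fun a b => G.faces a b ∨ (b = G.rot.symm a ∧ ¬ T a))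

variable {G} {T : X → Prop}

theorem region_of_face {x y : X} (h : G.face x = G.face y) : G.region T x y :=
  Relation.EqvGen.rel _ _ (Or.inl (Quotient.exact (s := G.faces) h))

theorem region_next (x : X) : G.region T x (G.next x) := region_of_face (G.face_next x).symm

theorem region_cross {x : X} (h : ¬ T x) : G.region T x (G.rot.symm x) :=
  Relation.EqvGen.rel _ _ (Or.inr ⟨rfl, h⟩)

theorem region_edge {x : X} (h : ¬ T x) : G.region T x (e x) :=
  (G.region T).trans (region_cross h) (region_of_face (G.face_edge x).symm)

theorem region_le {s : Setoid X} (h1 : ∀ x y, G.face x = G.face y → s x y)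
    (h2 : ∀ x, ¬ T x → s x (G.rot.symm x)) {x y : X} (h : G.region T x y) : s x y := by
  induction h with
  | rel x y h =>
    rcases h with h | ⟨rfl, h⟩
    · exact h1 _ _ (Quotient.sound (s := G.faces) h)
    · exact h2 _ h
  | refl x => exact s.refl x
  | symm x y _ ih => exact s.symm ih
  | trans x y z _ _ ih1 ih2 => exact s.trans ih1 ih2

variable (G) in
/-- The Euler characteristic of the face of `x`, evenly distributed over its corners. -/
noncomputable def chiHat (x : X) : ℚ :=
  (G.faceChi (G.face x) : ℚ) / ((Finset.univ.filter fun y => G.face y = G.face x).card : ℚ)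

theorem sum_chiHat (F : Finset X) (hF : ∀ x ∈ F, ∀ y, G.face y = G.face x → y ∈ F) :
    ∑ x ∈ F, G.chiHat x = ∑ f ∈ F.image G.face, (G.faceChi f : ℚ) := by
  rw [← Finset.sum_fiberwise_of_maps_to (g := G.face) (t := F.image G.face)
    (fun x hx => Finset.mem_image_of_mem _ hx)]
  refine Finset.sum_congr rfl fun f hf => ?_
  obtain ⟨x, hx, rfl⟩ := Finset.mem_image.1 hf
  have h1 : (F.filter fun y => G.face y = G.face x)
      = Finset.univ.filter fun y => G.face y = G.face x := by
    ext y
    simp only [Finset.mem_filter, Finset.mem_univ, true_and, and_iff_right_iff_imp]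
    exact hF x hx y
  have h2 : ((Finset.univ.filter fun y => G.face y = G.face x).card : ℚ) ≠ 0 := by
    rw [Nat.cast_ne_zero, ← Nat.pos_iff_ne_zero, Finset.card_pos]
    exact ⟨x, by simp⟩
  rw [h1, Finset.sum_congr rfl (g := fun _ => G.chiHat x)]
  · rw [Finset.sum_const, nsmul_eq_mul, chiHat, mul_div_cancel₀ _ h2]
  · intro y hy
    rw [chiHat, chiHat, (Finset.mem_filter.1 hy).2]

/-- The number of faces in a region exceeds the number of internal edges by at most one. -/
theorem card_faces_region_le (hT : ∀ x, T (e x) ↔ T x) (x₀ : X) :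
    2 * ((Finset.univ.filter fun x => G.region T x₀ x).image G.face).card ≤
      2 + (Finset.univ.filter fun x => G.region T x₀ x ∧ ¬ T x).card := by
  let V : Type _ := {f : G.Face // ∃ x, G.region T x₀ x ∧ G.face x = f}
  -- The dual graph of the region: its vertices are the faces, adjacent when they share an uncut
  -- edge. It is connected, so it has at most one more vertex than edges, and its darts inject into
  -- the uncut edge-endpoints.
  let H : SimpleGraph V :=
    { Adj := fun f g => f ≠ g ∧ ∃ x, ¬ T x ∧ G.face x = f.1 ∧ G.face (e x) = g.1
      symm := ⟨fun f g ⟨h, x, h1, h2, h3⟩ =>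
        ⟨h.symm, e x, by rwa [hT], h3, by rwa [G.edge_edge]⟩⟩
      loopless := ⟨fun f h => h.1 rfl⟩ }
  have key : ∀ a b, G.region T a b → ∀ (ha : G.region T x₀ a) (hb : G.region T x₀ b),
      H.Reachable ⟨G.face a, a, ha, rfl⟩ ⟨G.face b, b, hb, rfl⟩ := by
    intro a b h
    induction h with
    | rel x y h =>
      intro ha hb
      rcases h with h | ⟨rfl, h⟩
      · have : G.face x = G.face y := Quotient.sound (s := G.faces) h
        have h2 : (⟨G.face x, x, ha, rfl⟩ : V) = ⟨G.face y, y, hb, rfl⟩ := Subtype.ext this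
        rw [h2]
      · by_cases h3 : (⟨G.face x, x, ha, rfl⟩ : V) = ⟨G.face (G.rot.symm x), _, hb, rfl⟩
        · rw [h3]
        · exact SimpleGraph.Adj.reachable ⟨h3, x, h, rfl, G.face_edge x⟩
    | refl x => intro _ _; exact SimpleGraph.Reachable.refl _
    | symm x y _ ih => intro ha hb; exact (ih hb ha).symm
    | trans x y z hxy _ ih1 ih2 =>
      intro ha hb
      have : G.region T x₀ y := (G.region T).trans ha hxy
      exact (ih1 ha this).trans (ih2 this hb)
  have hconn : H.Connected := by
    rw [SimpleGraph.connected_iff]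
    refine ⟨?_, ⟨⟨G.face x₀, x₀, (G.region T).refl x₀, rfl⟩⟩⟩
    rintro ⟨_, a, ha, rfl⟩ ⟨_, b, hb, rfl⟩
    exact key a b ((G.region T).trans ((G.region T).symm ha) hb) ha hb
  have h1 := hconn.card_vert_le_card_edgeSet_add_one
  have h2 := H.dart_card_eq_twice_card_edges
  have h3 : Fintype.card H.Dart ≤ (Finset.univ.filter fun x => G.region T x₀ x ∧ ¬ T x).card := by
    have hd : ∀ d : H.Dart, ∃ x, ¬ T x ∧ G.face x = d.fst.1 ∧ G.face (e x) = d.snd.1 :=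
      fun d => d.adj.2
    choose φ hφ1 hφ2 hφ3 using hd
    rw [← Finset.card_univ]
    refine Finset.card_le_card_of_injOn φ ?_ ?_
    · intro d _
      simp only [Finset.coe_filter, Finset.mem_univ, true_and, Set.mem_ofPred_eq]
      refine ⟨?_, hφ1 d⟩
      obtain ⟨y, hy, hy2⟩ := d.fst.2
      exact (G.region T).trans hy (region_of_face (by rw [hy2, hφ2]))
    · intro d _ d' _ h
      refine SimpleGraph.Dart.ext _ _ (Prod.ext (Subtype.ext ?_) (Subtype.ext ?_))
      · exact (hφ2 d).symm.trans ((congrArg G.face h).trans (hφ2 d'))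
      · exact (hφ3 d).symm.trans ((congrArg (fun x => G.face (e x)) h).trans (hφ3 d'))
  have h4 : Nat.card V = ((Finset.univ.filter fun x => G.region T x₀ x).image G.face).card := by
    rw [Nat.card_eq_fintype_card, Fintype.card_subtype]
    congr 1
    ext f
    simp
  rw [Nat.card_eq_fintype_card (α := H.edgeSet), ← SimpleGraph.edgeFinset_card] at h1
  omega

/-- Twice the Euler characteristic of a region, where each internal edge counts once for each of
its two endpoints. -/
theorem sum_region_le_one (hT : ∀ x, T (e x) ↔ T x) (x₀ : X) :
    ∑ x with G.region T x₀ x, (G.chiHat x - if T x then 0 else 1 / 2) ≤ 1 := by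
  have h1 := card_faces_region_le (G := G) hT x₀
  have h2 := sum_chiHat (G := G) (Finset.univ.filter fun x => G.region T x₀ x) (by
    intro x hx y hy
    simp only [Finset.mem_filter, Finset.mem_univ, true_and] at hx ⊢
    exact (G.region T).trans hx (region_of_face hy.symm))
  have h3 : ∑ f ∈ (Finset.univ.filter fun x => G.region T x₀ x).image G.face, (G.faceChi f : ℚ)
      ≤ ((Finset.univ.filter fun x => G.region T x₀ x).image G.face).card := by
    rw [Finset.card_eq_sum_ones, Nat.cast_sum]
    refine Finset.sum_le_sum fun f _ => ?_
    exact_mod_cast G.faceChi_le_one f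
  rw [Finset.sum_sub_distrib, h2]
  have h4 : ∑ x with G.region T x₀ x, (if T x then (0 : ℚ) else 1 / 2)
      = (Finset.univ.filter fun x => G.region T x₀ x ∧ ¬ T x).card / 2 := by
    rw [← Finset.filter_filter, Finset.card_filter, Nat.cast_sum, Finset.sum_div]
    refine Finset.sum_congr rfl fun x _ => ?_
    by_cases h : T x <;> simp [h]
  rw [h4]
  have h5 : (2 : ℚ) * ((Finset.univ.filter fun x => G.region T x₀ x).image G.face).card ≤
      2 + (Finset.univ.filter fun x => G.region T x₀ x ∧ ¬ T x).card := by exact_mod_cast h1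
  linarith

/-- The bound by one counts every face as a disk; a single face of nonpositive characteristic saves
one. -/
theorem sum_region_le_zero (hT : ∀ x, T (e x) ↔ T x) (x₀ : X) {y : X} (hy : G.region T x₀ y)
    (hchi : G.faceChi (G.face y) ≤ 0) :
    ∑ x with G.region T x₀ x, (G.chiHat x - if T x then 0 else 1 / 2) ≤ 0 := by
  have h1 := card_faces_region_le (G := G) hT x₀
  have h2 := sum_chiHat (G := G) (Finset.univ.filter fun x => G.region T x₀ x) (by
    intro x hx y hy
    simp only [Finset.mem_filter, Finset.mem_univ, true_and] at hx ⊢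
    exact (G.region T).trans hx (region_of_face hy.symm))
  set S := (Finset.univ.filter fun x => G.region T x₀ x).image G.face with hS
  have hyS : G.face y ∈ S := Finset.mem_image_of_mem _ (by simpa using hy)
  have h3 : ∑ f ∈ S, (G.faceChi f : ℚ) ≤ (S.card : ℚ) - 1 := by
    rw [← Finset.add_sum_erase _ _ hyS]
    have h6 : ∑ f ∈ S.erase (G.face y), (G.faceChi f : ℚ) ≤ (S.erase (G.face y)).card := by
      rw [Finset.card_eq_sum_ones, Nat.cast_sum]
      refine Finset.sum_le_sum fun f _ => ?_
      exact_mod_cast G.faceChi_le_one f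
    have h7 : (S.erase (G.face y)).card + 1 = S.card := Finset.card_erase_add_one hyS
    have h8 : ((S.erase (G.face y)).card : ℚ) + 1 = S.card := by exact_mod_cast h7
    have h9 : (G.faceChi (G.face y) : ℚ) ≤ 0 := by exact_mod_cast hchi
    linarith
  rw [Finset.sum_sub_distrib, h2]
  have h4 : ∑ x with G.region T x₀ x, (if T x then (0 : ℚ) else 1 / 2)
      = (Finset.univ.filter fun x => G.region T x₀ x ∧ ¬ T x).card / 2 := by
    rw [← Finset.filter_filter, Finset.card_filter, Nat.cast_sum, Finset.sum_div]
    refine Finset.sum_congr rfl fun x _ => ?_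
    by_cases h : T x <;> simp [h]
  rw [h4]
  have h5 : (2 : ℚ) * S.card ≤
      2 + (Finset.univ.filter fun x => G.region T x₀ x ∧ ¬ T x).card := by exact_mod_cast h1
  linarith

/-- A function bounded above on each class of a setoid has a sum bounded above over each
saturated set. -/
theorem sum_le_zero_of_classes {s : Setoid X} (F : Finset X) (hF : ∀ x ∈ F, ∀ y, s x y → y ∈ F)
    (g : X → ℚ) (h : ∀ x ∈ F, ∑ y with s x y, g y ≤ 0) : ∑ x ∈ F, g x ≤ 0 := by
  rw [← Finset.sum_fiberwise_of_maps_to (g := fun x => Quotient.mk s x)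
    (t := F.image (Quotient.mk s)) (fun x hx => Finset.mem_image_of_mem _ hx)]
  refine Finset.sum_nonpos fun c hc => ?_
  obtain ⟨x, hx, rfl⟩ := Finset.mem_image.1 hc
  refine le_of_eq_of_le (Finset.sum_congr ?_ fun _ _ => rfl) (h x hx)
  ext y
  simp only [Finset.mem_filter, Finset.mem_univ, true_and]
  constructor
  · rintro ⟨_, h2⟩
    exact s.symm (Quotient.exact h2)
  · intro h2
    exact ⟨hF x hx y h2, (Quotient.sound h2).symm⟩

end EmbeddedGraph

/-! ### Boundary circles of faces -/

namespace EmbeddedGraph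

variable {X : Type*} [Fintype X] {e : Equiv.Perm X} {n : ℕ} {G : EmbeddedGraph e n}

theorem faceChi_le_zero_of_not_sameCycle {x y : X} (h : G.face x = G.face y)
    (hxy : ¬ G.next.SameCycle x y) : G.faceChi (G.face x) ≤ 0 := by
  have h1 : 1 < G.numBoundary (G.face x) := by
    rw [numBoundary, Set.one_lt_ncard_iff]
    refine ⟨_, _, ⟨x, rfl, rfl⟩, ⟨y, h.symm, rfl⟩, fun h2 => hxy (Quotient.exact h2)⟩
  rw [faceChi]
  omega

theorem eq_of_sameCycle_next {α : Type*} (f : X → α) {x y : X} (h : G.next.SameCycle x y)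
    (hf : ∀ z, G.face z = G.face x → f (G.next z) = f z) : f y = f x := by
  obtain ⟨k, -, rfl⟩ := h.exists_pow_eq'
  have : ∀ k : ℕ, G.face ((G.next ^ k) x) = G.face x ∧ f ((G.next ^ k) x) = f x := by
    intro k
    induction k with
    | zero => exact ⟨rfl, rfl⟩
    | succ k ih =>
      rw [pow_succ', Equiv.Perm.mul_apply]
      exact ⟨(G.face_next _).trans ih.1, (hf _ ih.1).trans ih.2⟩
  exact (this k).2

theorem two_mul_card_div_two {X : Type*} [Fintype X] {e : Equiv.Perm X} {n : ℕ}
    (G : EmbeddedGraph e n) : 2 * (Fintype.card X / 2) = Fintype.card X := by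
  have h : ∑ _x : X, (1 : ZMod 2) = 0 := by
    refine Finset.sum_involution (fun x _ => e x) (fun _ _ => by decide) (fun x _ _ => G.edge_ne x)
      (fun _ _ => Finset.mem_univ _) (fun x _ => G.edge_edge x)
  rw [Finset.sum_const, nsmul_eq_mul, mul_one, Finset.card_univ, ZMod.natCast_eq_zero_iff] at h
  omega

end EmbeddedGraph

/-! ### Types, cut edges and unrepresented regions -/

/-- The labels between two successive intervals with different values of the type `τ`. -/
def typeSwitches {m : ℕ} (τ : Fin m → ℤˣ) : Set (Fin m) := {l | τ ((finRotate m).symm l) ≠ τ l}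

namespace LabelledGraph

variable {X : Type*} [Fintype X] {e : Equiv.Perm X} {n m Δ : ℕ} (G : LabelledGraph e n m Δ)

/-- At a negative vertex the labels run clockwise, so the intervals on the two sides of an endpoint
are interchanged. Later sign arguments split along these two cases. -/
theorem interval_cases (x : X) :
    (G.sign (G.vert x) = 1 ∧ G.interval x = G.label x ∧
      G.interval (G.rot.symm x) = (finRotate m).symm (G.label x)) ∨
    (G.sign (G.vert x) = -1 ∧ G.interval x = (finRotate m).symm (G.label x) ∧
      G.interval (G.rot.symm x) = G.label x) := by
  have hv := G.vert_rot_symm x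
  rcases Int.units_eq_one_or (G.sign (G.vert x)) with h | h
  · left
    have h1 := G.label_pos (G.rot.symm x) (by rw [hv, h])
    rw [Equiv.apply_symm_apply] at h1
    refine ⟨h, by rw [interval, if_pos h], ?_⟩
    rw [interval, hv, if_pos h, h1, Equiv.symm_apply_apply]
  · right
    have hne : (-1 : ℤˣ) ≠ 1 := by decide
    have h1 := G.label_neg x h
    refine ⟨h, ?_, ?_⟩
    · rw [interval, h, if_neg hne, h1, Equiv.symm_apply_apply]
    · rw [interval, hv, h, if_neg hne, Equiv.apply_symm_apply]

/-- The sign of the corner `x` relative to the type `τ`. -/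
def orient (τ : Fin m → ℤˣ) (x : X) : ℤˣ := G.sign (G.vert x) * τ (G.interval x)

/-- The edges with a label in `K` and the edges along which `orient τ` changes. -/
def cut (K : Set (Fin m)) (τ : Fin m → ℤˣ) (x : X) : Prop :=
  G.label x ∈ K ∨ G.label (e x) ∈ K ∨ G.orient τ x ≠ G.orient τ (G.next x) ∨
    G.orient τ (e x) ≠ G.orient τ (G.next (e x))

/-- No component of positive Euler characteristic of the complement of `cut K τ` has all its
corners of the same sign relative to `τ`. -/
def NonRep (K : Set (Fin m)) (τ : Fin m → ℤˣ) : Prop :=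
  ∀ x₀, (∀ x, G.region (G.cut K τ) x₀ x → G.orient τ x = G.orient τ x₀) →
    ∑ x with G.region (G.cut K τ) x₀ x, (G.chiHat x - if G.cut K τ x then 0 else 1 / 2) ≤ 0

variable {G} {K : Set (Fin m)} {τ : Fin m → ℤˣ}

theorem cut_edge (x : X) : G.cut K τ (e x) ↔ G.cut K τ x := by
  simp only [cut, G.edge_edge]
  tauto

theorem value_rot_symm {α : Type*} (V : Fin m → α) {x : X}
    (h : V ((finRotate m).symm (G.label x)) = V (G.label x)) :
    V (G.interval (G.rot.symm x)) = V (G.interval x) := by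
  rcases G.interval_cases x with ⟨-, h2, h3⟩ | ⟨-, h2, h3⟩ <;> rw [h2, h3, h]

theorem orient_rot_symm (hK : typeSwitches τ ⊆ K) {x : X} (h : G.label x ∉ K) :
    G.orient τ (G.rot.symm x) = G.orient τ x := by
  rw [orient, orient, G.vert_rot_symm, value_rot_symm τ]
  by_contra h2
  exact h (hK h2)

/-- Off `K` the orientation is the same on both sides of an endpoint, so the two sides of the edge
show the same change. -/
theorem cut_iff (hK : typeSwitches τ ⊆ K) {x : X} (h1 : G.label x ∉ K) (h2 : G.label (e x) ∉ K) :
    G.cut K τ x ↔ G.orient τ x ≠ G.orient τ (G.next x) := by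
  have h3 : G.orient τ (G.next x) = G.orient τ (e x) := orient_rot_symm hK h2
  have h4 : G.orient τ (G.next (e x)) = G.orient τ x := by
    rw [G.next_edge]; exact orient_rot_symm hK h1
  rw [cut, h3, h4]
  constructor
  · rintro (h | h | h | h)
    · exact absurd h h1
    · exact absurd h h2
    · exact h
    · exact h.symm
  · intro h
    exact Or.inr (Or.inr (Or.inl h))

/-- Coherence is needed only along boundary walks. If it nevertheless fails in the region, two
corners of one face differ and lie on different boundary circles; that face is not a disk, so the
region has characteristic at most zero anyway. -/
theorem NonRep.sum_le_zero (hK : typeSwitches τ ⊆ K) (h : G.NonRep K τ) (x₀ : X)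
    (hch : ∀ x, G.region (G.cut K τ) x₀ x → G.orient τ (G.next x) = G.orient τ x) :
    ∑ x with G.region (G.cut K τ) x₀ x, (G.chiHat x - if G.cut K τ x then 0 else 1 / 2) ≤ 0 := by
  by_cases hc : ∀ x y, G.region (G.cut K τ) x₀ x → G.face x = G.face y →
      G.orient τ x = G.orient τ y
  · apply h
    have key : ∀ a b, G.region (G.cut K τ) a b → G.region (G.cut K τ) x₀ a →
        G.orient τ a = G.orient τ b := by
      intro a b hab
      induction hab with
      | rel x y hxy =>
        intro hx
        rcases hxy with hxy | ⟨rfl, hxy⟩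
        · exact hc x y hx (Quotient.sound (s := G.faces) hxy)
        · exact (orient_rot_symm hK fun h2 => hxy (Or.inl h2)).symm
      | refl x => intro _; rfl
      | symm x y hxy ih =>
        intro hy
        exact (ih ((G.region _).trans hy ((G.region _).symm hxy))).symm
      | trans x y z hxy _ ih1 ih2 =>
        intro hx
        exact (ih1 hx).trans (ih2 ((G.region _).trans hx hxy))
    exact fun x hx => (key x₀ x hx ((G.region _).refl x₀)).symm
  · push Not at hc
    obtain ⟨x, y, hx, hxy, hne⟩ := hc
    refine EmbeddedGraph.sum_region_le_zero cut_edge x₀ hx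
      (EmbeddedGraph.faceChi_le_zero_of_not_sameCycle hxy fun hcyc => hne ?_)
    refine (EmbeddedGraph.eq_of_sameCycle_next (G.orient τ) hcyc fun z hz => hch z ?_).symm
    exact (G.region _).trans hx (EmbeddedGraph.region_of_face hz.symm)

theorem sum_region_next {A : Type*} [AddCommMonoid A] {T : X → Prop} (x₀ : X) (g : X → A) :
    ∑ x with G.region T x₀ x, g (G.next x) = ∑ x with G.region T x₀ x, g x := by
  refine Finset.sum_equiv G.next (fun x => ?_) (fun _ _ => rfl)
  simp only [Finset.mem_filter, Finset.mem_univ, true_and]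
  have := EmbeddedGraph.region_next (G := G.toEmbeddedGraph) (T := T) x
  exact ⟨fun h => (G.region T).trans h this, fun h => (G.region T).trans h ((G.region T).symm this)⟩

/-- Orientation changes around a region come at least in pairs, and two halves already pay for the
maximal characteristic one. -/
theorem NonRep.sum_le_half_changes (hK : typeSwitches τ ⊆ K) (h : G.NonRep K τ) (x₀ : X) :
    ∑ x with G.region (G.cut K τ) x₀ x, ((G.chiHat x - if G.cut K τ x then 0 else 1 / 2) -
      if G.orient τ x = G.orient τ (G.next x) then 0 else 1 / 2) ≤ 0 := by
  rw [Finset.sum_sub_distrib]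
  set D := Finset.univ.filter fun x => G.region (G.cut K τ) x₀ x with hD
  by_cases hch : ∀ x ∈ D, G.orient τ (G.next x) = G.orient τ x
  · have h1 := h.sum_le_zero hK x₀ (fun x hx => hch x (by simpa [hD] using hx))
    have h2 : 0 ≤ ∑ x ∈ D, if G.orient τ x = G.orient τ (G.next x) then (0 : ℚ) else 1 / 2 :=
      Finset.sum_nonneg fun x _ => by split_ifs <;> norm_num
    linarith
  · push Not at hch
    obtain ⟨y, hy, hne⟩ := hch
    have h1 := EmbeddedGraph.sum_region_le_one (G := G.toEmbeddedGraph)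
      (cut_edge (G := G) (K := K) (τ := τ)) x₀
    -- The changes sum to zero because `next` permutes the region, so a single change cannot occur
    -- alone.
    have h2 : ∑ x ∈ D, (((G.orient τ (G.next x) : ℤˣ) : ℤ) - ((G.orient τ x : ℤˣ) : ℤ)) = 0 := by
      rw [Finset.sum_sub_distrib, sub_eq_zero]
      exact sum_region_next x₀ fun x => ((G.orient τ x : ℤˣ) : ℤ)
    have h3 : ∃ z ∈ D.erase y, G.orient τ (G.next z) ≠ G.orient τ z := by
      by_contra hcon
      push Not at hcon
      rw [← Finset.add_sum_erase _ _ hy, Finset.sum_eq_zero (s := D.erase y), add_zero,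
        sub_eq_zero] at h2
      · exact hne (Units.ext h2)
      · intro x hx
        rw [hcon x hx, sub_self]
    obtain ⟨z, hz, hzne⟩ := h3
    have h4 : (1 : ℚ) ≤ ∑ x ∈ D, if G.orient τ x = G.orient τ (G.next x) then (0 : ℚ) else 1 / 2 := by
      rw [← Finset.add_sum_erase _ _ hy, ← Finset.add_sum_erase _ _ hz, if_neg hne.symm,
        if_neg hzne.symm]
      have : 0 ≤ ∑ x ∈ (D.erase y).erase z,
          if G.orient τ x = G.orient τ (G.next x) then (0 : ℚ) else 1 / 2 :=
        Finset.sum_nonneg fun x _ => by split_ifs <;> norm_num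
      linarith
    linarith

theorem sum_chiHat_univ : ∑ x, G.chiHat x
    = (G.surfaceChi : ℚ) - n + (Fintype.card X : ℚ) / 2 := by
  have h1 := EmbeddedGraph.sum_chiHat (G := G.toEmbeddedGraph) Finset.univ
    (fun _ _ _ _ => Finset.mem_univ _)
  have h2 : Finset.univ.image G.face = Finset.univ := by
    ext f
    obtain ⟨x, rfl⟩ := Quotient.exists_rep f
    simp only [Finset.mem_image, Finset.mem_univ, true_and, iff_true]
    exact ⟨x, rfl⟩
  have h3 : ((2 * (Fintype.card X / 2) : ℕ) : ℚ) = Fintype.card X := by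
    exact_mod_cast G.two_mul_card_div_two
  rw [h1, h2, EmbeddedGraph.surfaceChi]
  generalize Fintype.card X / 2 = k at h3 ⊢
  push_cast at h3 ⊢
  linarith

/-- If no coherent region is a disk then there are few sides of cut edges along which the
orientation does not change. -/
theorem NonRep.card_unchanged_le (hK : typeSwitches τ ⊆ K) (h : G.NonRep K τ) :
    ((Finset.univ.filter fun x => G.cut K τ x ∧ G.orient τ x = G.orient τ (G.next x)).card : ℤ) ≤
      2 * ((n : ℤ) - G.surfaceChi) := by
  have h1 := EmbeddedGraph.sum_le_zero_of_classes (s := G.region (G.cut K τ)) Finset.univ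
    (fun _ _ _ _ => Finset.mem_univ _) _ (fun x _ => h.sum_le_half_changes hK x)
  rw [Finset.sum_sub_distrib, Finset.sum_sub_distrib, sum_chiHat_univ] at h1
  -- Each endpoint is of exactly one kind: uncut, changed, or cut and unchanged. A changed endpoint
  -- is always cut.
  have h2 : ∑ x, (if G.cut K τ x then (0 : ℚ) else 1 / 2) +
      ∑ x, (if G.orient τ x = G.orient τ (G.next x) then (0 : ℚ) else 1 / 2) +
      ((Finset.univ.filter fun x =>
        G.cut K τ x ∧ G.orient τ x = G.orient τ (G.next x)).card : ℚ) / 2 =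
      (Fintype.card X : ℚ) / 2 := by
    rw [Finset.card_filter, Nat.cast_sum, Finset.sum_div, ← Finset.sum_add_distrib,
      ← Finset.sum_add_distrib, ← Finset.card_univ, Finset.card_eq_sum_ones, Nat.cast_sum,
      Finset.sum_div]
    refine Finset.sum_congr rfl fun x _ => ?_
    by_cases h3 : G.orient τ x = G.orient τ (G.next x)
    · by_cases h4 : G.cut K τ x <;> simp [h3, h4]
    · have h4 : G.cut K τ x := Or.inr (Or.inr (Or.inl h3))
      simp [h3, h4]
  have h3 : ((Finset.univ.filter fun x =>
      G.cut K τ x ∧ G.orient τ x = G.orient τ (G.next x)).card : ℚ) ≤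
      2 * ((n : ℚ) - G.surfaceChi) := by linarith
  exact_mod_cast h3

/-! ### Transfer between types by level functions -/

/-- Integral levels on the intervals whose ascents, along the boundary of a face in a region that
is coherent for `σ`, are rare certify that no such region is a disk. -/
theorem NonRep.of_levels {Kt Ks : Set (Fin m)} {τ σ : Fin m → ℤˣ} (hτ : typeSwitches τ ⊆ Kt)
    (hσ : typeSwitches σ ⊆ Ks) (hK : Ks ⊆ Kt) (h : G.NonRep Kt τ) (V : Fin m → ℤ)
    (hflat : ∀ l ∉ Kt, V ((finRotate m).symm l) = V l)
    (hpar : ∀ u v, V u = V v → τ u * σ u = τ v * σ v)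
    (hbd : ∀ (r : ℤˣ) (x : X), G.orient σ x = r → G.orient σ (G.next x) = r →
      (G.label x ∈ Ks ∨ G.label (e x) ∈ Ks) →
      0 ≤ (r : ℤ) * (V (G.interval (G.next x)) - V (G.interval x)))
    (hint : ∀ (r : ℤˣ) (x : X), G.orient σ x = r → G.orient σ (e x) = r →
      G.label x ∉ Ks → G.label (e x) ∉ Ks →
      (r : ℤ) * (V (G.interval (G.next x)) - V (G.interval x)) < 0 →
      (r : ℤ) * (V (G.interval (G.next (e x))) - V (G.interval (e x))) < 0 → False) :
    G.NonRep Ks σ := by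
  intro x₀ hco
  set r := G.orient σ x₀ with hr
  obtain ⟨F, hF⟩ : ∃ F, F = Finset.univ.filter fun x => G.region (G.cut Ks σ) x₀ x := ⟨_, rfl⟩
  rw [← hF]
  have hFm : ∀ x, x ∈ F ↔ G.region (G.cut Ks σ) x₀ x := fun x => by simp [hF]
  have hFo : ∀ x ∈ F, G.orient σ x = r := fun x hx => hco x ((hFm x).1 hx)
  have hFnext : ∀ x, G.next x ∈ F ↔ x ∈ F := fun x => by
    have := EmbeddedGraph.region_next (G := G.toEmbeddedGraph) (T := G.cut Ks σ) x
    rw [hFm, hFm]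
    exact ⟨fun h => (G.region _).trans h ((G.region _).symm this), fun h => (G.region _).trans h this⟩
  have hFe : ∀ x ∈ F, ¬ G.cut Ks σ x → e x ∈ F := fun x hx hc =>
    (hFm _).2 ((G.region _).trans ((hFm _).1 hx) (EmbeddedGraph.region_edge hc))
  have hcut : ∀ x ∈ F, ¬ G.cut Kt τ x → ¬ G.cut Ks σ x := by
    intro x hx hc
    have h1 : G.label x ∉ Ks := fun h => hc (Or.inl (hK h))
    have h2 : G.label (e x) ∉ Ks := fun h => hc (Or.inr (Or.inl (hK h)))
    rw [cut_iff hσ h1 h2, not_not, hFo x hx, hFo _ ((hFnext x).2 hx)]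
  -- `asc` marks the cut sides along which `r * V` strictly drops. By `hbd` none of them lies on the
  -- boundary of `F`.
  obtain ⟨asc, hasc⟩ : ∃ asc : X → Prop, ∀ x, asc x ↔ G.cut Kt τ x ∧
    (r : ℤ) * (V (G.interval (G.next x)) - V (G.interval x)) < 0 := ⟨_, fun _ => Iff.rfl⟩
  have hascF : ∀ x ∈ F, asc x → ¬ G.cut Ks σ x := by
    intro x hx hax hc
    have hnx := hFo _ ((hFnext x).2 hx)
    by_cases hl : G.label x ∈ Ks ∨ G.label (e x) ∈ Ks
    · exact absurd (hbd r x (hFo x hx) hnx hl) (not_le.2 ((hasc x).1 hax).2)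
    · push Not at hl
      rw [cut_iff hσ hl.1 hl.2, hFo x hx, hnx] at hc
      exact hc rfl
  -- the classes of the finer decomposition
  have hsat : ∀ x ∈ F, ∀ y, G.region (G.cut Kt τ) x y → y ∈ F := by
    intro x hx y hxy
    let s : Setoid X := Setoid.ker (fun z => z ∈ F)
    have h1 : s x y := by
      refine EmbeddedGraph.region_le (G := G.toEmbeddedGraph) (T := G.cut Kt τ) ?_ ?_ hxy
      · intro a b hab
        refine propext ?_
        change a ∈ F ↔ b ∈ F
        have := EmbeddedGraph.region_of_face (G := G.toEmbeddedGraph) (T := G.cut Ks σ) hab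
        rw [hFm, hFm]
        exact ⟨fun h => (G.region _).trans h this,
          fun h => (G.region _).trans h ((G.region _).symm this)⟩
      · intro a ha
        refine propext ?_
        change a ∈ F ↔ G.rot.symm a ∈ F
        rw [← G.next_edge, hFnext]
        refine ⟨fun h => hFe a h (hcut a h ha), fun h => ?_⟩
        have := hFe (e a) h (hcut _ h (by rwa [cut_edge]))
        rwa [G.edge_edge] at this
    exact (show (x ∈ F) = (y ∈ F) from h1) ▸ hx
  -- Each finer component has characteristic at most its number of marked sides. One marked side
  -- suffices since the characteristic is at most one, so only components without marked sides
  -- matter.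
  have hclass : ∀ x ∈ F, ∑ y with G.region (G.cut Kt τ) x y,
      ((G.chiHat y - if G.cut Kt τ y then 0 else 1 / 2) - if asc y then 1 else 0) ≤ 0 := by
    intro x hx
    rw [Finset.sum_sub_distrib]
    obtain ⟨D, hD⟩ : ∃ D, D = Finset.univ.filter fun y => G.region (G.cut Kt τ) x y := ⟨_, rfl⟩
    rw [← hD]
    have hDm : ∀ y, y ∈ D ↔ G.region (G.cut Kt τ) x y := fun y => by simp [hD]
    by_cases ha : ∃ y ∈ D, asc y
    · obtain ⟨y, hy, hay⟩ := ha
      have h1 := EmbeddedGraph.sum_region_le_one (G := G.toEmbeddedGraph)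
        (cut_edge (G := G) (K := Kt) (τ := τ)) x
      rw [← hD] at h1
      have h2 : (1 : ℚ) ≤ ∑ y ∈ D, if asc y then (1 : ℚ) else 0 := by
        refine le_trans (le_of_eq (if_pos hay).symm)
          (Finset.single_le_sum (f := fun y => if asc y then (1 : ℚ) else 0) ?_ hy)
        intro i _
        split_ifs <;> norm_num
      linarith
    · push Not at ha
      have h2 : 0 ≤ ∑ y ∈ D, if asc y then (1 : ℚ) else 0 :=
        Finset.sum_nonneg fun x _ => by split_ifs <;> norm_num
      suffices h3 : ∀ y ∈ D, G.orient τ (G.next y) = G.orient τ y by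
        have := h.sum_le_zero hτ x (fun y hy => h3 y ((hDm y).2 hy))
        rw [← hD] at this
        linarith
      -- Level changes sum to zero over the component, and those along uncut edges cancel by
      -- `hflat`. The nonnegative changes along cut sides therefore all vanish, and `hpar` turns
      -- equal levels into equal orientation relative to `τ`.
      set L : X → ℤ := fun y => (r : ℤ) * V (G.interval y) with hL
      have hsum : ∑ y ∈ D, (L (G.next y) - L y) = 0 := by
        rw [Finset.sum_sub_distrib, sub_eq_zero]
        rw [hD]
        exact sum_region_next x L
      have hsum2 : ∑ y ∈ D with ¬ G.cut Kt τ y, (L (G.next y) - L y) = 0 := by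
        rw [Finset.sum_sub_distrib, sub_eq_zero]
        refine Finset.sum_equiv e (fun y => ?_) (fun y hy => ?_)
        · rw [Finset.mem_filter, Finset.mem_filter, cut_edge, hDm, hDm]
          refine and_congr_left fun hc => ?_
          have := EmbeddedGraph.region_edge (G := G.toEmbeddedGraph) hc
          exact ⟨fun h => (G.region _).trans h this,
            fun h => (G.region _).trans h ((G.region _).symm this)⟩
        · have hc := (Finset.mem_filter.1 hy).2
          rw [hL]
          dsimp only
          rw [G.next_apply, value_rot_symm V (hflat _ fun h => hc (Or.inr (Or.inl h)))]
      rw [← Finset.sum_filter_add_sum_filter_not D (fun y => G.cut Kt τ y), hsum2, add_zero] at hsum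
      have hge : ∀ y ∈ D.filter (fun y => G.cut Kt τ y), 0 ≤ L (G.next y) - L y := by
        intro y hy
        have h4 := ha y (Finset.mem_filter.1 hy).1
        have h5 := not_lt.1 fun h => h4 <| (hasc y).2 ⟨(Finset.mem_filter.1 hy).2, h⟩
        rw [hL]
        dsimp only
        linarith
      have hzero := (Finset.sum_eq_zero_iff_of_nonneg hge).1 hsum
      intro y hy
      by_cases hc : G.cut Kt τ y
      · have h6 := hzero y (Finset.mem_filter.2 ⟨hy, hc⟩)
        have h7 : V (G.interval (G.next y)) = V (G.interval y) := by
          rw [sub_eq_zero] at h6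
          exact mul_left_cancel₀ (Units.ne_zero r) h6
        have h8 := hpar _ _ h7
        have hyF := hsat x hx y ((hDm y).1 hy)
        have h9 := (hFo _ ((hFnext y).2 hyF)).trans (hFo y hyF).symm
        rw [orient, orient] at h9 ⊢
        have e1 : ∀ a b c : ℤˣ, a * b = (a * c) * (b * c) := by decide
        rw [e1 _ _ (σ (G.interval (G.next y))), h9, e1 _ (τ (G.interval y)) (σ (G.interval y)),
          h8]
      · by_contra h10
        exact hc (Or.inr (Or.inr (Or.inl (Ne.symm h10))))
  have htotal := EmbeddedGraph.sum_le_zero_of_classes (s := G.region (G.cut Kt τ)) F hsat _ hclass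
  -- Only edges cut for `τ` but internal to `F` contribute. Pairing the two endpoints of such an
  -- edge, at most one is marked, against a cost of `1/2` each.
  have hasum : ∑ x ∈ F, ((if asc x then (1 : ℚ) else 0) + (if G.cut Kt τ x then 0 else 1 / 2) -
      if G.cut Ks σ x then 0 else 1 / 2) ≤ 0 := by
    have h1 : ∑ x ∈ F, ((if asc x then (1 : ℚ) else 0) + (if G.cut Kt τ x then 0 else 1 / 2) -
        if G.cut Ks σ x then 0 else 1 / 2) = ∑ x ∈ F with ¬ G.cut Ks σ x,
        ((if asc x then (1 : ℚ) else 0) - if G.cut Kt τ x then 1 / 2 else 0) := by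
      rw [Finset.sum_filter]
      refine Finset.sum_congr rfl fun x hx => ?_
      by_cases h1 : G.cut Ks σ x
      · have h2 : ¬ asc x := fun h => hascF x hx h h1
        have h3 : G.cut Kt τ x := by
          by_contra h3
          exact hcut x hx h3 h1
        simp [h1, h2, h3]
      · by_cases h3 : G.cut Kt τ x <;> simp [h1, h3]
    have h2 : ∑ x ∈ F with ¬ G.cut Ks σ x,
        ((if asc (e x) then (1 : ℚ) else 0) - if G.cut Kt τ (e x) then 1 / 2 else 0) =
        ∑ x ∈ F with ¬ G.cut Ks σ x,
        ((if asc x then (1 : ℚ) else 0) - if G.cut Kt τ x then 1 / 2 else 0) := by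
      refine Finset.sum_equiv e (fun y => ?_) (fun y hy => rfl)
      rw [Finset.mem_filter, Finset.mem_filter, cut_edge]
      refine and_congr_left fun hc => ⟨fun h => hFe y h hc, fun h => ?_⟩
      have := hFe (e y) h (by rwa [cut_edge])
      rwa [G.edge_edge] at this
    have h3 : ∑ x ∈ F with ¬ G.cut Ks σ x,
        (((if asc x then (1 : ℚ) else 0) - if G.cut Kt τ x then 1 / 2 else 0) +
        ((if asc (e x) then (1 : ℚ) else 0) - if G.cut Kt τ (e x) then 1 / 2 else 0)) ≤ 0 := by
      refine Finset.sum_nonpos fun x hx => ?_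
      obtain ⟨hxF, hc⟩ := Finset.mem_filter.1 hx
      have hce : G.cut Kt τ (e x) ↔ G.cut Kt τ x := cut_edge x
      have hnot : ¬ (asc x ∧ asc (e x)) := fun ⟨ha, hb⟩ =>
        hint r x (hFo x hxF) (hFo _ (hFe x hxF hc)) (fun h => hc (Or.inl h))
          (fun h => hc (Or.inr (Or.inl h))) ((hasc _).1 ha).2 ((hasc _).1 hb).2
      by_cases h4 : G.cut Kt τ x
      · by_cases ha : asc x
        · have hb : ¬ asc (e x) := fun hb => hnot ⟨ha, hb⟩
          simp only [hce, ha, hb, h4, if_true, if_false]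
          norm_num
        · by_cases hb : asc (e x) <;> simp only [hce, ha, hb, h4, if_true, if_false] <;> norm_num
      · have ha : ¬ asc x := fun ha => h4 ((hasc _).1 ha).1
        have hb : ¬ asc (e x) := fun hb => h4 ((cut_edge x).1 ((hasc _).1 hb).1)
        simp [hce, ha, hb, h4]
    rw [Finset.sum_add_distrib, h2] at h3
    rw [h1]
    linarith
  have hcomb : ∑ x ∈ F, (G.chiHat x - if G.cut Ks σ x then (0 : ℚ) else 1 / 2) =
      ∑ x ∈ F, ((G.chiHat x - if G.cut Kt τ x then 0 else 1 / 2) - if asc x then 1 else 0) +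
      ∑ x ∈ F, ((if asc x then (1 : ℚ) else 0) + (if G.cut Kt τ x then 0 else 1 / 2) -
        if G.cut Ks σ x then 0 else 1 / 2) := by
    rw [← Finset.sum_add_distrib]
    refine Finset.sum_congr rfl fun x _ => ?_
    ring
  rw [hcomb]
  linarith

end LabelledGraph

/-! ### Rises and falls; the initial type -/

/-- The labels at which the type `τ` changes from `-1` to `1`. -/
def typeRises {m : ℕ} (τ : Fin m → ℤˣ) : Set (Fin m) :=
  {l | τ ((finRotate m).symm l) = -1 ∧ τ l = 1}

/-- The labels at which the type `τ` changes from `1` to `-1`. -/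
def typeFalls {m : ℕ} (τ : Fin m → ℤˣ) : Set (Fin m) :=
  {l | τ ((finRotate m).symm l) = 1 ∧ τ l = -1}

section Types

variable {m : ℕ} (τ : Fin m → ℤˣ)

theorem typeFalls_neg : typeFalls (-τ) = typeRises τ := by
  ext l
  simp only [typeFalls, typeRises, Set.mem_ofPred_eq, Pi.neg_apply, neg_eq_iff_eq_neg, neg_neg]

theorem typeRises_neg : typeRises (-τ) = typeFalls τ := by
  ext l
  simp only [typeFalls, typeRises, Set.mem_ofPred_eq, Pi.neg_apply, neg_eq_iff_eq_neg, neg_neg]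

theorem typeSwitches_neg : typeSwitches (-τ) = typeSwitches τ := by
  ext l
  simp only [typeSwitches, Set.mem_ofPred_eq, Pi.neg_apply, ne_eq, neg_inj]

theorem typeSwitches_eq : typeSwitches τ = typeFalls τ ∪ typeRises τ := by
  ext l
  simp only [typeSwitches, typeFalls, typeRises, Set.mem_union, Set.mem_ofPred_eq]
  generalize τ ((finRotate m).symm l) = a
  generalize τ l = b
  revert a b
  decide

variable {τ}

theorem typeFalls_subset : typeFalls τ ⊆ typeSwitches τ := by
  rw [typeSwitches_eq]; exact Set.subset_union_left

theorem typeRises_subset : typeRises τ ⊆ typeSwitches τ := by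
  rw [typeSwitches_eq]; exact Set.subset_union_right

theorem eq_of_notMem_typeSwitches {l : Fin m} (h : l ∉ typeSwitches τ) :
    τ ((finRotate m).symm l) = τ l := not_not.1 h

end Types

namespace LabelledGraph

variable {X : Type*} [Fintype X] {e : Equiv.Perm X} {n m Δ : ℕ} {G : LabelledGraph e n m Δ}

theorem orient_neg (τ : Fin m → ℤˣ) (x : X) : G.orient (-τ) x = - G.orient τ x := by
  rw [orient, orient, Pi.neg_apply, mul_neg]

theorem cut_neg (K : Set (Fin m)) (τ : Fin m → ℤˣ) : G.cut K (-τ) = G.cut K τ := by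
  funext x
  simp only [cut, orient_neg, ne_eq, neg_inj]

theorem nonRep_neg {K : Set (Fin m)} {τ : Fin m → ℤˣ} : G.NonRep K (-τ) ↔ G.NonRep K τ := by
  simp only [NonRep, orient_neg, neg_inj]
  rw [cut_neg]

/-- When every edge is cut the regions are faces. A coherent face of positive characteristic is a
disk, coherence rules out cancellation in its vector, and the absence of trivial loops gives it at
least two corners; it would represent `τ`. -/
theorem nonRep_univ (hloop : G.NoTrivialLoops) {τ : Fin m → ℤˣ}
    (h : ¬ ∃ D, G.FaceRepresents D τ) : G.NonRep Set.univ τ := by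
  intro x₀ hco
  have hcut : ∀ x, G.cut Set.univ τ x := fun x => Or.inl trivial
  have hreg : ∀ x, G.region (G.cut Set.univ τ) x₀ x ↔ G.face x = G.face x₀ := by
    intro x
    refine ⟨fun hx => ?_, fun hx => EmbeddedGraph.region_of_face hx.symm⟩
    have : (Setoid.ker G.face) x₀ x :=
      EmbeddedGraph.region_le (fun _ _ h => h) (fun y hy => absurd (hcut y) hy) hx
    exact Eq.symm this
  simp only [hreg] at hco ⊢
  have hsum : ∑ x with G.face x = G.face x₀, (G.chiHat x - if G.cut Set.univ τ x then 0 else 1 / 2)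
      = G.faceChi (G.face x₀) := by
    simp only [hcut, if_true, sub_zero]
    rw [EmbeddedGraph.sum_chiHat]
    · have : (Finset.univ.filter fun x => G.face x = G.face x₀).image G.face = {G.face x₀} := by
        ext f
        simp only [Finset.mem_image, Finset.mem_filter, Finset.mem_univ, true_and,
          Finset.mem_singleton]
        exact ⟨fun ⟨x, hx, h⟩ => h ▸ hx, fun h => ⟨x₀, rfl, h.symm⟩⟩
      rw [this, Finset.sum_singleton]
    · intro x hx y hy
      simp only [Finset.mem_filter, Finset.mem_univ, true_and] at hx ⊢
      exact hy.trans hx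
  rw [hsum]
  by_contra hpos
  have hpos : 0 < G.faceChi (G.face x₀) := by exact_mod_cast not_le.1 hpos
  have hdisk : G.IsDisk (G.face x₀) := by
    have := G.numBoundary_pos (G.face x₀)
    rw [EmbeddedGraph.faceChi] at hpos
    constructor <;> omega
  have hsign : ∀ x, G.face x = G.face x₀ →
      G.sign (G.vert x) = G.orient τ x₀ * τ (G.interval x) := by
    intro x hx
    rw [← hco x hx, orient, mul_assoc, Int.units_mul_self, mul_one]
  have hvec : ∀ i, G.faceVector (G.face x₀) i = ((G.orient τ x₀ * τ i : ℤˣ) : ℤ) *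
      (Finset.univ.filter fun x => G.face x = G.face x₀ ∧ G.interval x = i).card := by
    intro i
    rw [faceVector, Finset.sum_congr rfl (g := fun _ => ((G.orient τ x₀ * τ i : ℤˣ) : ℤ)),
      Finset.sum_const, nsmul_eq_mul, mul_comm]
    intro x hx
    simp only [Finset.mem_filter, Finset.mem_univ, true_and] at hx
    rw [hsign x hx.1, hx.2]
  refine h ⟨G.face x₀, hdisk, ⟨⟨G.orient τ x₀, fun i hi => ?_⟩, ?_⟩, fun x y hx hy hxy => ?_⟩
  · rw [hvec] at hi ⊢
    have h1 : (0 : ℤ) < (Finset.univ.filter fun x =>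
        G.face x = G.face x₀ ∧ G.interval x = i).card := by
      have := right_ne_zero_of_mul hi
      omega
    rw [Int.sign_mul, Int.sign_eq_one_of_pos h1, mul_one]
    rcases Int.units_eq_one_or (G.orient τ x₀ * τ i) with h2 | h2 <;> rw [h2] <;> rfl
  · have h1 : ∀ i, |G.faceVector (G.face x₀) i| =
        ((Finset.univ.filter fun x => G.face x = G.face x₀ ∧ G.interval x = i).card : ℤ) := by
      intro i
      rw [hvec, abs_mul, Int.isUnit_iff_abs_eq.1 (Units.isUnit _), one_mul, abs_of_nonneg]
      positivity
    have h2 : (Finset.univ.filter fun x => G.face x = G.face x₀).card =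
        ∑ i, (Finset.univ.filter fun x => G.face x = G.face x₀ ∧ G.interval x = i).card := by
      rw [Finset.card_eq_sum_card_fiberwise (f := G.interval) (t := Finset.univ)
        (fun _ _ => Finset.mem_coe.2 (Finset.mem_univ _))]
      simp only [Finset.filter_filter]
    have h3 : 1 < (Finset.univ.filter fun x => G.face x = G.face x₀).card := by
      rw [Finset.one_lt_card]
      refine ⟨x₀, by simp, G.next x₀, by simpa using G.face_next x₀, fun h => ?_⟩
      exact hloop x₀ hdisk h.symm
    rw [Finset.sum_congr rfl fun i _ => h1 i, ← Nat.cast_sum, ← h2]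
    exact_mod_cast h3
  · rw [hsign x hx, hsign y hy, hxy]

/-- A type is not represented by regions if the descents of another one are rare. -/
theorem NonRep.of_orient {Kt Ks : Set (Fin m)} {τ σ : Fin m → ℤˣ} (hτ : typeSwitches τ ⊆ Kt)
    (hσ : typeSwitches σ ⊆ Ks) (hK : Ks ⊆ Kt) (h : G.NonRep Kt τ)
    (hbd : ∀ x : X, G.orient σ x = G.orient σ (G.next x) →
      (G.label x ∈ Ks ∨ G.label (e x) ∈ Ks) →
      G.orient τ x = 1 → G.orient τ (G.next x) = -1 → False)
    (hint : ∀ x : X, G.orient σ x = G.orient σ (e x) → G.label x ∉ Ks → G.label (e x) ∉ Ks →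
      G.label x ∈ typeRises τ → G.label (e x) ∈ typeRises τ → False) :
    G.NonRep Ks σ := by
  have hV : ∀ (r : ℤˣ) (x : X), G.orient σ x = r →
      (r : ℤ) * ((σ (G.interval x) * τ (G.interval x) : ℤˣ) : ℤ) = (G.orient τ x : ℤˣ) := by
    intro r x hx
    rw [← hx, ← Units.val_mul]
    congr 1
    rw [orient, orient]
    generalize G.sign (G.vert x) = a
    generalize σ (G.interval x) = b
    generalize τ (G.interval x) = c
    revert a b c
    decide
  have hlt : ∀ a b : ℤˣ, (a : ℤ) - (b : ℤ) < 0 → b = 1 ∧ a = -1 := by decide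
  have hrise : ∀ x, G.orient τ x = 1 → G.orient τ (G.rot.symm x) = -1 →
      G.label x ∈ typeRises τ := by
    intro x h1 h2
    rw [orient] at h1 h2
    rw [G.vert_rot_symm] at h2
    rcases G.interval_cases x with ⟨h3, h4, h5⟩ | ⟨h3, h4, h5⟩ <;>
      rw [h3, h4] at h1 <;> rw [h3, h5] at h2
    · exact ⟨by simpa using h2, by simpa using h1⟩
    · exact ⟨by simpa [neg_eq_iff_eq_neg] using h1, by simpa [neg_eq_iff_eq_neg] using h2⟩
  refine h.of_levels hτ hσ hK (fun u => ((σ u * τ u : ℤˣ) : ℤ)) ?_ ?_ ?_ ?_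
  · intro l hl
    rw [eq_of_notMem_typeSwitches fun h => hl (hτ h),
      eq_of_notMem_typeSwitches fun h => hl (hK (hσ h))]
  · intro u v huv
    rw [mul_comm (τ u), mul_comm (τ v)]
    exact Units.ext huv
  · intro r x hx hnx hl
    rw [mul_sub, hV r x hx, hV r _ hnx]
    by_contra hcon
    obtain ⟨h1, h2⟩ := hlt _ _ (not_le.1 hcon)
    exact hbd x (hx.trans hnx.symm) hl h1 h2
  · intro r x hx hex hl hel h1 h2
    have hnx : G.orient σ (G.next x) = r := (orient_rot_symm hσ hel).trans hex
    have hnex : G.orient σ (G.next (e x)) = r := by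
      rw [G.next_edge]; exact (orient_rot_symm hσ hl).trans hx
    rw [mul_sub, hV r x hx, hV r _ hnx] at h1
    rw [mul_sub, hV r _ hex, hV r _ hnex, G.next_edge] at h2
    obtain ⟨h3, h4⟩ := hlt _ _ h1
    obtain ⟨h5, h6⟩ := hlt _ _ h2
    exact hint x (hx.trans hex.symm) hl hel (hrise x h3 h6) (hrise (e x) h5 h4)

theorem NonRep.mono {K K' : Set (Fin m)} {τ : Fin m → ℤˣ} (hτ : typeSwitches τ ⊆ K')
    (hK : K' ⊆ K) (h : G.NonRep K τ) : G.NonRep K' τ := by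
  refine h.of_orient (hτ.trans hK) hτ hK ?_ ?_
  · intro x hx _ h1 h2
    rw [h1, h2] at hx
    exact absurd hx (by decide)
  · intro x _ hl _ h1 _
    exact hl (hτ (typeRises_subset h1))

/-- A negative vertex reverses both the order of the intervals and the sign, so the orientations
around a fall do not depend on the sign of the vertex. -/
theorem orient_of_mem_typeFalls {τ : Fin m → ℤˣ} {x : X} (h : G.label x ∈ typeFalls τ) :
    G.orient τ x = -1 ∧ G.orient τ (G.rot.symm x) = 1 := by
  rw [orient, orient, G.vert_rot_symm]
  rcases G.interval_cases x with ⟨h3, h4, h5⟩ | ⟨h3, h4, h5⟩ <;>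
    rw [h3, h4, h5, h.1, h.2] <;> decide

end LabelledGraph

/-! ### Combinatorics of the derived type -/

/-- `a` is the first element of `H` in the sequence `l, f l, f (f l), …`. -/
inductive FirstAlong {α : Type*} (f : α → α) (H : Set α) : α → α → Prop
  | here {l : α} : l ∈ H → FirstAlong f H l l
  | step {l a : α} : l ∉ H → FirstAlong f H (f l) a → FirstAlong f H l a

namespace FirstAlong

variable {α : Type*} {f : α → α} {H : Set α} {l a b : α}

theorem eq_of_mem (hl : l ∈ H) (h : FirstAlong f H l a) : a = l := by
  cases h with
  | here _ => rfl
  | step h _ => exact absurd hl h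

theorem step_iff (hl : l ∉ H) : FirstAlong f H l a ↔ FirstAlong f H (f l) a := by
  refine ⟨fun h => ?_, step hl⟩
  cases h with
  | here h => exact absurd h hl
  | step _ h => exact h

theorem unique (h : FirstAlong f H l a) (h' : FirstAlong f H l b) : a = b := by
  induction h with
  | here h => exact (eq_of_mem h h').symm
  | step hl _ ih => exact ih ((step_iff hl).1 h')

end FirstAlong

theorem eq_of_finRotate {α : Type*} {m : ℕ} {f : Fin m → α} (h : ∀ l, f (finRotate m l) = f l)
    (l l' : Fin m) : f l = f l' := by
  cases m with
  | zero => exact l.elim0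
  | succ m =>
    have key : ∀ i, f i = f 0 := by
      intro i
      induction i using Fin.induction with
      | zero => rfl
      | succ i ih =>
        rw [← ih, ← h i.castSucc, finRotate_apply, Fin.coeSucc_eq_succ]
    rw [key l, key l']

section Derivative

variable {m : ℕ} {ε : Fin m → ℤˣ} {τ : Fin m → ℤˣ} {J : Set (Fin m)} {κ : ℤˣ}

/-- `a` is the rise of `τ` outside `J` that lies in the same interval of the complement of `J` and
the falls of `τ` as `u`. -/
def RiseNear (τ : Fin m → ℤˣ) (J : Set (Fin m)) (u a : Fin m) : Prop :=
  a ∉ J ∧ (τ u = -1 ∧ FirstAlong (finRotate m) (J ∪ typeSwitches τ) (finRotate m u) a ∨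
    τ u = 1 ∧ FirstAlong (finRotate m).symm (J ∪ typeSwitches τ) u a)

theorem RiseNear.unique {u a b : Fin m} (h : RiseNear τ J u a) (h' : RiseNear τ J u b) : a = b := by
  obtain ⟨-, ⟨h1, h2⟩ | ⟨h1, h2⟩⟩ := h <;> obtain ⟨-, ⟨h3, h4⟩ | ⟨h3, h4⟩⟩ := h'
  · exact h2.unique h4
  · rw [h1] at h3; exact absurd h3 (by decide)
  · rw [h1] at h3; exact absurd h3 (by decide)
  · exact h2.unique h4

theorem riseNear_left {a : Fin m} (ha : a ∈ typeRises τ) (haJ : a ∉ J) :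
    RiseNear τ J ((finRotate m).symm a) a :=
  ⟨haJ, Or.inl ⟨ha.1, by
    rw [Equiv.apply_symm_apply]; exact .here (Or.inr (typeRises_subset ha))⟩⟩

theorem riseNear_right {a : Fin m} (ha : a ∈ typeRises τ) (haJ : a ∉ J) : RiseNear τ J a a :=
  ⟨haJ, Or.inr ⟨ha.2, .here (Or.inr (typeRises_subset ha))⟩⟩

theorem riseNear_congr {l a : Fin m} (hJ : l ∉ J) (hl : l ∉ typeSwitches τ) :
    RiseNear τ J ((finRotate m).symm l) a ↔ RiseNear τ J l a := by
  have hH : l ∉ J ∪ typeSwitches τ := fun h => h.elim hJ hl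
  rw [RiseNear, RiseNear, eq_of_notMem_typeSwitches hl, Equiv.apply_symm_apply,
    FirstAlong.step_iff (f := finRotate m) hH, FirstAlong.step_iff (f := (finRotate m).symm) hH]

theorem RiseNear.mem_typeRises {u a : Fin m} (h : RiseNear τ J u a) : a ∈ typeRises τ := by
  obtain ⟨haJ, ⟨h1, h2⟩ | ⟨h1, h2⟩⟩ := h
  · have key : ∀ l, FirstAlong (finRotate m) (J ∪ typeSwitches τ) l a →
        τ ((finRotate m).symm l) = -1 → a ∈ typeRises τ := by
      clear h2
      intro l h
      induction h with
      | here h =>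
        intro h3
        refine ⟨h3, ?_⟩
        have := h.resolve_left haJ
        rcases Int.units_eq_one_or (τ _) with h4 | h4
        · exact h4
        · exact absurd (h3.trans h4.symm) this
      | step h _ ih =>
        intro h3
        refine ih haJ ?_
        rw [Equiv.symm_apply_apply]
        exact (eq_of_notMem_typeSwitches fun h4 => h (Or.inr h4)).symm.trans h3
    exact key _ h2 (by rwa [Equiv.symm_apply_apply])
  · have key : ∀ l, FirstAlong (finRotate m).symm (J ∪ typeSwitches τ) l a →
        τ l = 1 → a ∈ typeRises τ := by
      clear h2
      intro l h
      induction h with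
      | here h =>
        intro h3
        refine ⟨?_, h3⟩
        have := h.resolve_left haJ
        rcases Int.units_eq_one_or (τ ((finRotate m).symm _)) with h4 | h4
        · exact absurd (h4.trans h3.symm) this
        · exact h4
      | step h _ ih =>
        intro h3
        exact ih haJ ((eq_of_notMem_typeSwitches fun h4 => h (Or.inr h4)).trans h3)
    exact key _ h2 h1

/-- Outside `J`, the type `τ'` has at least the falls and at most the rises of `τ`. -/
def Shadows (τ τ' : Fin m → ℤˣ) (J : Set (Fin m)) : Prop :=
  (∀ l ∈ typeFalls τ, l ∉ J → l ∈ typeFalls τ') ∧ ∀ l ∈ typeRises τ', l ∉ J → l ∈ typeRises τ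

/-- The rise `a` is also a rise of `τ`. Between `u` and `a` a fall of `τ` would be a switch of `τ'`,
so on the way from `a` to `u` the value of `τ` never changes. -/
theorem RiseNear.of_shadows {τ' : Fin m → ℤˣ} (hs : Shadows τ τ' J) {u a : Fin m}
    (h : RiseNear τ' J u a) : RiseNear τ ∅ u a := by
  have ha := hs.2 a h.mem_typeRises h.1
  obtain ⟨haJ, ⟨h1, h2⟩ | ⟨h1, h2⟩⟩ := h
  · have key : ∀ l, FirstAlong (finRotate m) (J ∪ typeSwitches τ') l a →
        FirstAlong (finRotate m) (∅ ∪ typeSwitches τ) l a ∧ τ ((finRotate m).symm l) = -1 := by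
      clear h2
      intro l h
      induction h with
      | here h => exact ⟨.here (Or.inr (typeRises_subset ha)), ha.1⟩
      | @step l b h _ ih =>
        obtain ⟨h3, h4⟩ := ih ha haJ
        rw [Equiv.symm_apply_apply] at h4
        have h5 : l ∉ typeFalls τ := fun h5 =>
          h (Or.inr (typeFalls_subset (hs.1 l h5 fun h6 => h (Or.inl h6))))
        have h6 : τ ((finRotate m).symm l) = -1 := by
          rcases Int.units_eq_one_or (τ ((finRotate m).symm l)) with h7 | h7
          · exact absurd ⟨h7, h4⟩ h5
          · exact h7
        refine ⟨.step ?_ h3, h6⟩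
        rintro (h7 | h7)
        · exact h7
        · exact h7 (h6.trans h4.symm)
    obtain ⟨h3, h4⟩ := key _ h2
    rw [Equiv.symm_apply_apply] at h4
    exact ⟨fun h => h, Or.inl ⟨h4, h3⟩⟩
  · have key : ∀ l, FirstAlong (finRotate m).symm (J ∪ typeSwitches τ') l a →
        FirstAlong (finRotate m).symm (∅ ∪ typeSwitches τ) l a ∧ τ l = 1 := by
      clear h2
      intro l h
      induction h with
      | here h => exact ⟨.here (Or.inr (typeRises_subset ha)), ha.2⟩
      | @step l b h _ ih =>
        obtain ⟨h3, h4⟩ := ih ha haJ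
        have h5 : l ∉ typeFalls τ := fun h5 =>
          h (Or.inr (typeFalls_subset (hs.1 l h5 fun h6 => h (Or.inl h6))))
        have h6 : τ l = 1 := by
          rcases Int.units_eq_one_or (τ l) with h7 | h7
          · exact h7
          · exact absurd ⟨h4, h7⟩ h5
        refine ⟨.step ?_ h3, h6⟩
        rintro (h7 | h7)
        · exact h7
        · exact h7 (h4.trans h6.symm)
    obtain ⟨h3, h4⟩ := key _ h2
    exact ⟨fun h => h, Or.inr ⟨h4, h3⟩⟩

/-- The derived type: on an interval of the complement of `J` and the falls of `τ`, it is the sign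
of the rise of `τ` in that interval, if there is one, and `κ τ` if there is none. -/
noncomputable def derivedType (ε τ : Fin m → ℤˣ) (J : Set (Fin m)) (κ : ℤˣ) (u : Fin m) : ℤˣ :=
  if h : ∃ a, RiseNear τ J u a then ε h.choose else κ * τ u

theorem derivedType_of_riseNear {u a : Fin m} (h : RiseNear τ J u a) :
    derivedType ε τ J κ u = ε a := by
  have hex : ∃ a, RiseNear τ J u a := ⟨a, h⟩
  rw [derivedType, dif_pos hex, hex.choose_spec.unique h]

theorem derivedType_of_not {u : Fin m} (h : ¬ ∃ a, RiseNear τ J u a) :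
    derivedType ε τ J κ u = κ * τ u := by
  rw [derivedType, dif_neg h]

theorem derivedType_eq {l : Fin m} (hJ : l ∉ J) (hl : l ∉ typeFalls τ) :
    derivedType ε τ J κ ((finRotate m).symm l) = derivedType ε τ J κ l := by
  by_cases hr : l ∈ typeRises τ
  · rw [derivedType_of_riseNear (riseNear_left hr hJ), derivedType_of_riseNear (riseNear_right hr hJ)]
  · have hs : l ∉ typeSwitches τ := by
      rw [typeSwitches_eq]
      exact fun h => h.elim hl hr
    by_cases h : ∃ a, RiseNear τ J l a
    · obtain ⟨a, ha⟩ := h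
      rw [derivedType_of_riseNear ha, derivedType_of_riseNear ((riseNear_congr hJ hs).2 ha)]
    · rw [derivedType_of_not h, derivedType_of_not, eq_of_notMem_typeSwitches hs]
      simpa only [riseNear_congr hJ hs] using h

theorem typeSwitches_derivedType :
    typeSwitches (derivedType ε τ J κ) ⊆ typeFalls τ ∪ J := by
  intro l hl
  by_contra h
  rw [Set.mem_union, not_or] at h
  exact hl (derivedType_eq h.2 h.1)

theorem derivedType_left {j : Fin m} (hj : j ∈ J) (h : τ ((finRotate m).symm j) = -1) :
    derivedType ε τ J κ ((finRotate m).symm j) = -κ := by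
  rw [derivedType_of_not, h, mul_neg_one]
  rintro ⟨a, ha, ⟨-, h2⟩ | ⟨h1, -⟩⟩
  · rw [Equiv.apply_symm_apply] at h2
    exact ha (h2.eq_of_mem (Set.mem_union_left _ hj) ▸ hj)
  · rw [h] at h1; exact absurd h1 (by decide)

theorem derivedType_right {j : Fin m} (hj : j ∈ J) (h : τ j = 1) :
    derivedType ε τ J κ j = κ := by
  rw [derivedType_of_not, h, mul_one]
  rintro ⟨a, ha, ⟨h1, -⟩ | ⟨-, h2⟩⟩
  · rw [h] at h1; exact absurd h1 (by decide)
  · exact ha (h2.eq_of_mem (Set.mem_union_left _ hj) ▸ hj)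

/-- Where a rise of `τ'` is near, both derived types take its sign; elsewhere the shadow takes the
value `κ τ'`. Off `J` all switches sit at falls of `τ'`, where `κ τ'` goes from `κ` to `-κ`. So `κ =
1` can only create falls and destroy rises, and `κ = -1` does the same after negation. -/
theorem derivedType_shadows {τ' : Fin m → ℤˣ} (hs : Shadows τ τ' J) (κ' : ℤˣ) :
    Shadows (derivedType ε τ ∅ κ') (derivedType ε τ' J 1) J ∧
      Shadows (-derivedType ε τ ∅ κ') (-derivedType ε τ' J (-1)) J := by
  have hB : ∀ (κ : ℤˣ) (u : Fin m), derivedType ε τ' J κ u = derivedType ε τ ∅ κ' u ∨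
      derivedType ε τ' J κ u = κ * τ' u := by
    intro κ u
    by_cases h : ∃ a, RiseNear τ' J u a
    · obtain ⟨a, ha⟩ := h
      left
      rw [derivedType_of_riseNear ha, derivedType_of_riseNear (ha.of_shadows hs)]
    · right
      rw [derivedType_of_not h]
  have hfall : ∀ l, l ∈ typeSwitches (derivedType ε τ ∅ κ') → l ∉ J → l ∈ typeFalls τ' := by
    intro l hl hJ
    rcases typeSwitches_derivedType hl with h | h
    · exact hs.1 l h hJ
    · exact absurd h (Set.notMem_empty l)
  have hfall' : ∀ κ l, l ∈ typeSwitches (derivedType ε τ' J κ) → l ∉ J → l ∈ typeFalls τ' :=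
    fun κ l hl hJ => (typeSwitches_derivedType hl).resolve_right hJ
  have hne : (-1 : ℤˣ) ≠ 1 := by decide
  refine ⟨⟨fun l hl hJ => ?_, fun l hl hJ => ?_⟩, ?_, ?_⟩
  · obtain ⟨h1, h2⟩ := hfall l (typeFalls_subset hl) hJ
    obtain ⟨h3, h4⟩ := hl
    constructor
    · rcases hB 1 ((finRotate m).symm l) with h | h <;> rw [h]
      exacts [h3, by rw [h1, one_mul]]
    · rcases hB 1 l with h | h <;> rw [h]
      exacts [h4, by rw [h2, one_mul]]
  · obtain ⟨h1, h2⟩ := hfall' 1 l (typeRises_subset hl) hJ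
    obtain ⟨h3, h4⟩ := hl
    constructor
    · rcases hB 1 ((finRotate m).symm l) with h | h
      · rw [← h, h3]
      · rw [h, h1] at h3; exact absurd h3.symm (by decide)
    · rcases hB 1 l with h | h
      · rw [← h, h4]
      · rw [h, h2] at h4; exact absurd h4 (by decide)
  · rw [typeFalls_neg, typeFalls_neg]
    intro l hl hJ
    obtain ⟨h1, h2⟩ := hfall l (typeRises_subset hl) hJ
    obtain ⟨h3, h4⟩ := hl
    constructor
    · rcases hB (-1) ((finRotate m).symm l) with h | h <;> rw [h]
      exacts [h3, by rw [h1, mul_one]]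
    · rcases hB (-1) l with h | h <;> rw [h]
      exacts [h4, by rw [h2]; decide]
  · rw [typeRises_neg, typeRises_neg]
    intro l hl hJ
    obtain ⟨h1, h2⟩ := hfall' (-1) l (typeFalls_subset hl) hJ
    obtain ⟨h3, h4⟩ := hl
    constructor
    · rcases hB (-1) ((finRotate m).symm l) with h | h
      · rw [← h, h3]
      · rw [h, h1] at h3; exact absurd h3 (by decide)
    · rcases hB (-1) l with h | h
      · rw [← h, h4]
      · rw [h, h2] at h4; exact absurd h4 (by decide)

/-- The derived type has a switch if the rises do not all have the same sign. -/
theorem typeSwitches_derivedType_nonempty {a b : Fin m} (ha : a ∈ typeRises τ)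
    (hb : b ∈ typeRises τ) (hab : ε a ≠ ε b) :
    (typeSwitches (derivedType ε τ ∅ κ)).Nonempty := by
  by_contra hcon
  rw [Set.not_nonempty_iff_eq_empty] at hcon
  have h1 : ∀ l, derivedType ε τ ∅ κ (finRotate m l) = derivedType ε τ ∅ κ l := by
    intro l
    have h2 := eq_of_notMem_typeSwitches (τ := derivedType ε τ ∅ κ) (l := finRotate m l)
      (by rw [hcon]; exact Set.notMem_empty _)
    rw [Equiv.symm_apply_apply] at h2
    exact h2.symm
  have h2 := fun l l' => eq_of_finRotate h1 l l'
  apply hab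
  rw [← derivedType_of_riseNear (ε := ε) (κ := κ) (riseNear_right ha (Set.notMem_empty a)), h2 a b,
    derivedType_of_riseNear (riseNear_right hb (Set.notMem_empty b))]

end Derivative

/-! ### Persistence under derivation -/

namespace LabelledGraph

variable {X : Type*} [Fintype X] {e : Equiv.Perm X} {n m Δ : ℕ} (G : LabelledGraph e n m Δ)

/-- The parity rule, for the signs `ε` of the labels. -/
def Parity (ε : Fin m → ℤˣ) : Prop :=
  ∀ x, G.sign (G.vert (e x)) * ε (G.label (e x)) = -(G.sign (G.vert x) * ε (G.label x))

/-- All edges with a label in `J` have their other label in `J ∪ L`. -/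
def EdgesInto (J L : Set (Fin m)) : Prop := ∀ x, G.label x ∈ J → G.label (e x) ∈ J ∪ L

variable {G} {ε : Fin m → ℤˣ}

/-- If both labels of an edge are rises off `J`, the derived orientations at its ends are the signed
labels, which parity makes opposite, so the edge is not internal to a coherent region. If the
`τ`-orientation goes from `1` to `-1` along a cut edge, neither label is a fall, so both lie in `J`;
there the derived type is `κ τ` and its orientation changes as well. -/
theorem NonRep.derivedType {τ : Fin m → ℤˣ} {J : Set (Fin m)} (hε : G.Parity ε)
    (h : G.NonRep (J ∪ typeSwitches τ) τ) (hJ : G.EdgesInto J (typeFalls τ)) (κ : ℤˣ) :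
    G.NonRep (J ∪ typeSwitches (derivedType ε τ J κ)) (derivedType ε τ J κ) := by
  have hsub : typeSwitches (_root_.derivedType ε τ J κ) ⊆ typeFalls τ ∪ J :=
    typeSwitches_derivedType
  have hne : (-1 : ℤˣ) ≠ 1 := by decide
  refine h.of_orient Set.subset_union_right Set.subset_union_right ?_ ?_ ?_
  · rintro l (hl | hl)
    · exact Or.inl hl
    · exact (hsub hl).elim (fun h => Or.inr (typeFalls_subset h)) Or.inl
  · intro x hx hl h1 h2
    have hf1 : G.label x ∉ typeFalls τ := fun hf =>
      hne ((orient_of_mem_typeFalls hf).1.symm.trans h1)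
    have hf2 : G.label (e x) ∉ typeFalls τ := fun hf =>
      hne (h2.symm.trans (orient_of_mem_typeFalls hf).2)
    have hl' : G.label x ∈ J ∨ G.label (e x) ∈ J := by
      rcases hl with (hl | hl) | (hl | hl)
      · exact Or.inl hl
      · exact Or.inl ((hsub hl).resolve_left hf1)
      · exact Or.inr hl
      · exact Or.inr ((hsub hl).resolve_left hf2)
    have hJ1 : G.label x ∈ J := by
      rcases hl' with hl' | hl'
      · exact hl'
      · have := hJ _ hl'
        rw [G.edge_edge] at this
        exact this.resolve_right hf1
    have hJ2 : G.label (e x) ∈ J := (hJ _ hJ1).resolve_right hf2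
    have h3 : G.orient (_root_.derivedType ε τ J κ) x = κ := by
      rw [orient] at h1 ⊢
      rcases G.interval_cases x with ⟨h3, h4, -⟩ | ⟨h3, h4, -⟩ <;> rw [h3, h4] at h1 ⊢
      · rw [derivedType_right hJ1 (by simpa using h1), one_mul]
      · rw [derivedType_left hJ1 (by simpa [neg_eq_iff_eq_neg] using h1)]
        simp
    have h4 : G.orient (_root_.derivedType ε τ J κ) (G.next x) = -κ := by
      rw [G.next_apply] at h2 ⊢
      rw [orient, G.vert_rot_symm] at h2 ⊢
      rcases G.interval_cases (e x) with ⟨h3, -, h4⟩ | ⟨h3, -, h4⟩ <;> rw [h3, h4] at h2 ⊢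
      · rw [derivedType_left hJ2 (by rwa [one_mul] at h2), one_mul]
      · rw [derivedType_right hJ2 (by simpa using h2)]
        simp
    rw [h3, h4] at hx
    revert hx
    clear * -
    revert κ
    decide
  · intro x hx hl hel hr1 hr2
    have hJ1 : G.label x ∉ J := fun h => hl (Or.inl h)
    have hJ2 : G.label (e x) ∉ J := fun h => hel (Or.inl h)
    have key : ∀ y, G.label y ∉ J → G.label y ∈ typeRises τ →
        G.orient (_root_.derivedType ε τ J κ) y = G.sign (G.vert y) * ε (G.label y) := by
      intro y hy hr
      rw [orient]
      rcases G.interval_cases y with ⟨-, h4, -⟩ | ⟨-, h4, -⟩ <;> rw [h4]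
      · rw [derivedType_of_riseNear (riseNear_right hr hy)]
      · rw [derivedType_of_riseNear (riseNear_left hr hy)]
    rw [key x hJ1 hr1, key _ hJ2 hr2, hε x] at hx
    revert hx
    generalize G.sign (G.vert x) * ε (G.label x) = a
    clear * -
    revert a
    decide

variable (G) in
/-- The type `τ` with switches in `B` is not represented by regions, and has shadows with the same
property for suitable subsets of `B`. -/
def Persistent (B : Set (Fin m)) (τ : Fin m → ℤˣ) : Prop :=
  typeSwitches τ ⊆ B ∧ G.NonRep (typeSwitches τ) τ ∧
    ∀ J ⊆ B, G.EdgesInto J (typeSwitches τ) →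
      (∃ τ', G.NonRep (J ∪ typeSwitches τ') τ' ∧ Shadows τ τ' J) ∧
        ∃ τ', G.NonRep (J ∪ typeSwitches τ') τ' ∧ Shadows (-τ) (-τ') J

theorem Persistent.of_nonRep {B : Set (Fin m)} {τ : Fin m → ℤˣ} (hτ : typeSwitches τ ⊆ B)
    (h : G.NonRep B τ) : G.Persistent B τ := by
  refine ⟨hτ, h.mono subset_rfl hτ, fun J hJ _ => ?_⟩
  have h1 : G.NonRep (J ∪ typeSwitches τ) τ :=
    h.mono Set.subset_union_right (Set.union_subset hJ hτ)
  exact ⟨⟨τ, h1, fun l hl _ => hl, fun l hl _ => hl⟩, ⟨τ, h1, fun l hl _ => hl, fun l hl _ => hl⟩⟩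

theorem Persistent.neg {B : Set (Fin m)} {τ : Fin m → ℤˣ} (h : G.Persistent B τ) :
    G.Persistent B (-τ) := by
  obtain ⟨h1, h2, h3⟩ := h
  rw [Persistent, typeSwitches_neg, nonRep_neg]
  refine ⟨h1, h2, fun J hJ hE => ?_⟩
  obtain ⟨⟨τ₁, h4, h5⟩, τ₂, h6, h7⟩ := h3 J hJ hE
  refine ⟨⟨-τ₂, ?_, h7⟩, ⟨-τ₁, ?_, ?_⟩⟩
  · rwa [typeSwitches_neg, nonRep_neg]
  · rwa [typeSwitches_neg, nonRep_neg]
  · rwa [neg_neg, neg_neg]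

theorem EdgesInto.mono {J L L' : Set (Fin m)} (h : G.EdgesInto J L)
    (hL : ∀ l ∈ L, l ∉ J → l ∈ L') : G.EdgesInto J L' := by
  intro x hx
  by_cases h1 : G.label (e x) ∈ J
  · exact Or.inl h1
  · exact Or.inr (hL _ ((h x hx).resolve_left h1) h1)

theorem typeSwitches_derivedType_empty {τ : Fin m → ℤˣ} {κ : ℤˣ} :
    typeSwitches (_root_.derivedType ε τ ∅ κ) ⊆ typeFalls τ := by
  intro l hl
  exact (typeSwitches_derivedType hl).resolve_right (Set.notMem_empty l)

/-- The switches of the derivative are falls of `τ`, hence off `J` falls of any shadow `τ'`, so the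
shadow can be derived too. Deriving it with `1` and with `-1` gives the two required shadows. -/
theorem Persistent.derivedType {B : Set (Fin m)} {τ : Fin m → ℤˣ} (hε : G.Parity ε)
    (h : G.Persistent B τ) : G.Persistent B (derivedType ε τ ∅ 1) := by
  obtain ⟨h1, h2, h3⟩ := h
  refine ⟨typeSwitches_derivedType_empty.trans (typeFalls_subset.trans h1), ?_, fun J hJ hE => ?_⟩
  · have h4 := NonRep.derivedType (J := ∅) hε (by rwa [Set.empty_union])
      (fun x hx => absurd hx (Set.notMem_empty _)) 1
    rwa [Set.empty_union] at h4
  · have hE' : G.EdgesInto J (typeFalls τ) := hE.mono fun l hl _ => typeSwitches_derivedType_empty hl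
    obtain ⟨⟨τ', h4, h5⟩, -⟩ := h3 J hJ (hE'.mono fun l hl _ => typeFalls_subset hl)
    have hE'' : G.EdgesInto J (typeFalls τ') := hE'.mono h5.1
    obtain ⟨h6, h7⟩ := derivedType_shadows (ε := ε) h5 1
    exact ⟨⟨_, h4.derivedType hε hE'' 1, h6⟩, ⟨_, h4.derivedType hε hE'' (-1), h7⟩⟩

/-- By repeated derivation one reaches a type whose rises all have the same sign and whose falls
all have the same sign. -/
theorem Persistent.exists_constant {B : Set (Fin m)} {τ : Fin m → ℤˣ} (hε : G.Parity ε)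
    (h : G.Persistent B τ) (hne : (typeSwitches τ).Nonempty) :
    ∃ τ', G.Persistent B τ' ∧ (typeSwitches τ').Nonempty ∧
      (∀ a ∈ typeRises τ', ∀ b ∈ typeRises τ', ε a = ε b) ∧
      ∀ a ∈ typeFalls τ', ∀ b ∈ typeFalls τ', ε a = ε b := by
  obtain ⟨k, hk⟩ : ∃ k, (typeSwitches τ).ncard = k := ⟨_, rfl⟩
  induction k using Nat.strong_induction_on generalizing τ with
  | _ k ih =>
    have key : ∀ τ : Fin m → ℤˣ, G.Persistent B τ → (typeSwitches τ).ncard = k →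
        ¬ (∀ a ∈ typeRises τ, ∀ b ∈ typeRises τ, ε a = ε b) →
        ∃ τ', G.Persistent B τ' ∧ (typeSwitches τ').Nonempty ∧
          (∀ a ∈ typeRises τ', ∀ b ∈ typeRises τ', ε a = ε b) ∧
          ∀ a ∈ typeFalls τ', ∀ b ∈ typeFalls τ', ε a = ε b := by
      intro τ hτ hk hcon
      push Not at hcon
      obtain ⟨a, ha, b, hb, hab⟩ := hcon
      -- Derivation loses every rise, so the number of switches drops; two rises of different sign
      -- leave at least one switch.
      refine ih _ ?_ (hτ.derivedType hε) (typeSwitches_derivedType_nonempty ha hb hab) rfl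
      rw [← hk]
      refine Set.ncard_lt_ncard ⟨typeSwitches_derivedType_empty.trans typeFalls_subset, fun h => ?_⟩
        (Set.toFinite _)
      have := typeSwitches_derivedType_empty (h (typeRises_subset ha))
      exact absurd (this.2.symm.trans ha.2) (by decide)
    by_cases hr : ∀ a ∈ typeRises τ, ∀ b ∈ typeRises τ, ε a = ε b
    · by_cases hf : ∀ a ∈ typeFalls τ, ∀ b ∈ typeFalls τ, ε a = ε b
      · exact ⟨τ, h, hne, hr, hf⟩
      · refine key (-τ) h.neg (by rwa [typeSwitches_neg]) ?_
        rwa [typeRises_neg]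
    · exact key τ h hk hr

end LabelledGraph

/-! ### Modes: confining the switches to `J` -/

section Mode

variable {m : ℕ} {ε τ : Fin m → ℤˣ} {J : Set (Fin m)} {s : ℤˣ}

/-- A function that is constant on the intervals of the complement of `J`, except that it may
change from `0` to `2` at a fall of `τ` of sign `s`; at the ends of these intervals it is subject
to conditions. -/
structure IsMode (ε τ : Fin m → ℤˣ) (J : Set (Fin m)) (s : ℤˣ) (M : Fin m → Fin 3) : Prop where
  const : ∀ l ∉ J, ¬ (l ∈ typeFalls τ ∧ ε l = s) → M ((finRotate m).symm l) = M l
  fall : ∀ l ∉ J, l ∈ typeFalls τ → ε l = s → M ((finRotate m).symm l) ≠ 1 ∧ M l = 2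
  first_high : ∀ j ∈ J, M j = 2 → ε j = s ∧ τ j = -1
  first_mid : ∀ j ∈ J, M j = 1 → ε j = s → τ j = 1
  last_low : ∀ j ∈ J, M ((finRotate m).symm j) = 0 → ε j = s ∧ τ ((finRotate m).symm j) = 1
  last_mid : ∀ j ∈ J, M ((finRotate m).symm j) = 1 → ε j = s → τ ((finRotate m).symm j) = -1

theorem exists_isMode (ε τ : Fin m → ℤˣ) (J : Set (Fin m)) (s : ℤˣ) : ∃ M, IsMode ε τ J s M := by
  let H : Set (Fin m) := J ∪ {l | l ∈ typeFalls τ ∧ ε l = s}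
  let After : Fin m → Prop := fun u => ∃ a, a ∉ J ∧ FirstAlong (finRotate m).symm H u a
  let Before : Fin m → Prop := fun u => ∃ a, a ∉ J ∧ FirstAlong (finRotate m) H (finRotate m u) a
  let Last : Fin m → Prop := fun u => ∃ j, FirstAlong (finRotate m) J (finRotate m u) j ∧ ε j = s ∧
    τ ((finRotate m).symm j) = 1
  let First : Fin m → Prop := fun u => ∃ j, FirstAlong (finRotate m).symm J u j ∧ ε j = s ∧ τ j = -1
  -- In a piece of the complement of `J` that contains falls of sign `s`, the mode is `0` before the
  -- first and `2` afterwards. In a piece without them it is constant: `0` or `2` if an end rules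
  -- out the value `1`, otherwise `1`.
  let M : Fin m → Fin 3 := fun u =>
    if After u then 2 else if Before u then 0 else if Last u then 0 else if First u then 2 else 1
  have hM : ∀ u, M u = if After u then 2 else if Before u then 0 else if Last u then 0
    else if First u then 2 else 1 := fun _ => rfl
  have hAfter : ∀ j ∈ J, ¬ After j := by
    rintro j hj ⟨a, ha, h⟩
    exact ha (h.eq_of_mem (Set.mem_union_left _ hj) ▸ hj)
  have hBefore : ∀ j ∈ J, ¬ Before ((finRotate m).symm j) := by
    rintro j hj ⟨a, ha, h⟩
    rw [Equiv.apply_symm_apply] at h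
    exact ha (h.eq_of_mem (Set.mem_union_left _ hj) ▸ hj)
  have hFirst : ∀ j ∈ J, (First j ↔ ε j = s ∧ τ j = -1) := by
    intro j hj
    constructor
    · rintro ⟨a, h, h1⟩
      rwa [h.eq_of_mem hj] at h1
    · exact fun h => ⟨j, .here hj, h⟩
  have hLast : ∀ j ∈ J, (Last ((finRotate m).symm j) ↔ ε j = s ∧ τ ((finRotate m).symm j) = 1) := by
    intro j hj
    constructor
    · rintro ⟨a, h, h1⟩
      rw [Equiv.apply_symm_apply] at h
      rwa [h.eq_of_mem hj] at h1
    · exact fun h => ⟨j, by rw [Equiv.apply_symm_apply]; exact .here hj, h⟩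
  refine ⟨M, ⟨?_, ?_, ?_, ?_, ?_, ?_⟩⟩
  · intro l hJ hl
    have hH : l ∉ H := fun h => h.elim hJ hl
    have h1 : After ((finRotate m).symm l) = After l := by
      simp only [After, FirstAlong.step_iff (f := (finRotate m).symm) hH]
    have h2 : Before ((finRotate m).symm l) = Before l := by
      simp only [Before, FirstAlong.step_iff (f := finRotate m) hH, Equiv.apply_symm_apply]
    have h3 : Last ((finRotate m).symm l) = Last l := by
      simp only [Last, FirstAlong.step_iff (f := finRotate m) hJ, Equiv.apply_symm_apply]
    have h4 : First ((finRotate m).symm l) = First l := by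
      simp only [First, FirstAlong.step_iff (f := (finRotate m).symm) hJ]
    simp only [hM, h1, h2, h3, h4]
  · intro l hJ hl hε
    have h1 : After l := ⟨l, hJ, .here (Or.inr ⟨hl, hε⟩)⟩
    have h2 : Before ((finRotate m).symm l) :=
      ⟨l, hJ, by rw [Equiv.apply_symm_apply]; exact .here (Or.inr ⟨hl, hε⟩)⟩
    rw [hM, hM, if_pos h1, if_pos h2]
    refine ⟨?_, rfl⟩
    split_ifs <;> decide
  · intro j hj h
    rw [hM, if_neg (hAfter j hj)] at h
    rw [← hFirst j hj]
    by_contra hF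
    rw [if_neg hF] at h
    split_ifs at h <;> exact absurd h (by decide)
  · intro j hj h hε
    rw [hM, if_neg (hAfter j hj)] at h
    rcases Int.units_eq_one_or (τ j) with hτ | hτ
    · exact hτ
    · rw [if_pos ((hFirst j hj).2 ⟨hε, hτ⟩)] at h
      split_ifs at h <;> exact absurd h (by decide)
  · intro j hj h
    rw [hM, if_neg (hBefore j hj)] at h
    rw [← hLast j hj]
    by_contra hF
    rw [if_neg hF] at h
    split_ifs at h <;> exact absurd h (by decide)
  · intro j hj h hε
    rw [hM, if_neg (hBefore j hj)] at h
    rcases Int.units_eq_one_or (τ ((finRotate m).symm j)) with hτ | hτ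
    · rw [if_pos ((hLast j hj).2 ⟨hε, hτ⟩)] at h
      split_ifs at h <;> exact absurd h (by decide)
    · exact hτ

end Mode

namespace LabelledGraph

variable {X : Type*} [Fintype X] {e : Equiv.Perm X} {n m Δ : ℕ} {G : LabelledGraph e n m Δ}
  {ε τ : Fin m → ℤˣ} {J : Set (Fin m)} {s : ℤˣ}

theorem orient_cases (σ : Fin m → ℤˣ) (x : X) :
    (G.sign (G.vert x) = 1 ∧ G.interval x = G.label x ∧
      G.interval (G.rot.symm x) = (finRotate m).symm (G.label x) ∧
      G.orient σ x = σ (G.label x) ∧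
      G.orient σ (G.rot.symm x) = σ ((finRotate m).symm (G.label x))) ∨
    (G.sign (G.vert x) = -1 ∧ G.interval x = (finRotate m).symm (G.label x) ∧
      G.interval (G.rot.symm x) = G.label x ∧
      G.orient σ x = -σ ((finRotate m).symm (G.label x)) ∧
      G.orient σ (G.rot.symm x) = -σ (G.label x)) := by
  rw [orient, orient, G.vert_rot_symm]
  rcases G.interval_cases x with ⟨h1, h2, h3⟩ | ⟨h1, h2, h3⟩
  · left; rw [h1, h2, h3]; simp
  · right; rw [h1, h2, h3]; simp

theorem modeLevel_bounds {M : Fin m → Fin 3} (hM : IsMode ε τ J s M) {y : X}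
    (hy : G.label y ∈ J ∨ G.label y ∈ typeFalls τ ∧ ε (G.label y) = s) (r : ℤˣ) :
    (G.orient (fun u => modeSign (M u)) y = r →
      0 ≤ (r : ℤ) * (2 - modeLevel (M (G.interval y)) (τ (G.interval y))) + 1 ∧
      (G.sign (G.vert y) * ε (G.label y) ≠ r * s →
        0 ≤ (r : ℤ) * (2 - modeLevel (M (G.interval y)) (τ (G.interval y))) - 1)) ∧
    (G.orient (fun u => modeSign (M u)) (G.rot.symm y) = r →
      0 ≤ (r : ℤ) *
        (modeLevel (M (G.interval (G.rot.symm y))) (τ (G.interval (G.rot.symm y))) - 2) + 1 ∧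
      (G.sign (G.vert y) * ε (G.label y) ≠ r * s →
        0 ≤ (r : ℤ) *
          (modeLevel (M (G.interval (G.rot.symm y))) (τ (G.interval (G.rot.symm y))) - 2) - 1)) := by
  have hl : (M (G.label y) = 2 → ε (G.label y) = s ∧ τ (G.label y) = -1) ∧
      (M (G.label y) = 1 → ε (G.label y) = s → τ (G.label y) = 1) ∧
      (M ((finRotate m).symm (G.label y)) = 0 →
        ε (G.label y) = s ∧ τ ((finRotate m).symm (G.label y)) = 1) ∧
      (M ((finRotate m).symm (G.label y)) = 1 →
        ε (G.label y) = s → τ ((finRotate m).symm (G.label y)) = -1) := by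
    by_cases hJ : G.label y ∈ J
    · exact ⟨hM.first_high _ hJ, hM.first_mid _ hJ, hM.last_low _ hJ, hM.last_mid _ hJ⟩
    · obtain ⟨h1, h2⟩ := hy.resolve_left hJ
      obtain ⟨h3, h4⟩ := hM.fall _ hJ h1 h2
      refine ⟨fun _ => ⟨h2, h1.2⟩, fun h => ?_, fun _ => ⟨h2, h1.1⟩, fun h => absurd h h3⟩
      rw [h4] at h
      exact absurd h (by decide)
  obtain ⟨k1, k2, k3, k4⟩ := hl
  rcases G.orient_cases (fun u => modeSign (M u)) y with ⟨h1, h2, h3, h4, h5⟩ | ⟨h1, h2, h3, h4, h5⟩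
  · rw [h1, h2, h3, h4, h5]
    exact ⟨modeLevel_first_pos _ _ _ _ _ k1 k2, modeLevel_last_pos _ _ _ _ _ k3 k4⟩
  · rw [h1, h2, h3, h4, h5]
    exact ⟨modeLevel_last_neg _ _ _ _ _ k3 k4, modeLevel_first_neg _ _ _ _ _ k1 k2⟩

theorem levelStep {M : Fin m → Fin 3} (hM : IsMode ε τ J s M) {y : X}
    (hy : G.label y ∉ J) {r : ℤˣ} (hr : G.orient (fun u => modeSign (M u)) y = r) :
    LevelStep (modeLevel (M (G.interval y)) (τ (G.interval y)))
      (modeLevel (M (G.interval (G.rot.symm y))) (τ (G.interval (G.rot.symm y)))) r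
      (ε (G.label y)) s (G.sign (G.vert y)) (G.label y ∈ typeRises τ) := by
  have k1 := hM.const _ hy
  have k2 := fun h => hM.fall _ hy (And.left h) (And.right h)
  rcases G.orient_cases (fun u => modeSign (M u)) y with ⟨h1, h2, h3, h4, h5⟩ | ⟨h1, h2, h3, h4, h5⟩
  · rw [h4] at hr
    rw [h1, h2, h3]
    exact levelStep_pos _ _ _ _ _ _ _ k1 k2 hr
  · rw [h4] at hr
    rw [h1, h2, h3]
    exact levelStep_neg _ _ _ _ _ _ _ k1 k2 hr

/-- Levels are odd and steps are at most two, so drops on both sides force two full steps between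
the same pair of levels. If they cross the middle, both signed labels equal `r * s`; if not, both
labels are rises with equal label signs and equal vertex signs. Either contradicts parity. -/
theorem _root_.LevelStep.not_both {v w v' w' : ℤ} {r f s g f' g' : ℤˣ} {A A' : Prop}
    (h : LevelStep v w r f s g A) (h' : LevelStep v' w' r f' s g' A') (hv : v % 2 = 1)
    (hw : w % 2 = 1) (hv' : v' % 2 = 1) (hw' : w' % 2 = 1) (hpar : g' * f' = -(g * f))
    (hA : A → A' → f = f') (h1 : (r : ℤ) * (w' - v) < 0) (h2 : (r : ℤ) * (w - v') < 0) : False := by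
  have hne : ∀ a : ℤˣ, a ≠ -a := by
    intro a ha
    rcases Int.units_eq_one_or a with rfl | rfl <;> exact absurd ha (by decide)
  have key : (g * f = r * s ∧ g' * f' = r * s) ∨ (A ∧ g = r) ∧ (A' ∧ g' = r) := by
    unfold LevelStep at h h'
    rcases Int.units_eq_one_or r with rfl | rfl <;>
    · simp only [Units.val_one, Units.val_neg] at h h' h1 h2
      rcases h with h | ⟨h, ⟨ha, hb⟩ | ⟨ha, hb⟩⟩ <;> rcases h' with h' | ⟨h', ⟨ha', hb'⟩ | ⟨ha', hb'⟩⟩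
      all_goals first | (exfalso; omega) | exact Or.inl ⟨hb, hb'⟩ | exact Or.inr ⟨hb, hb'⟩
  rcases key with ⟨h3, h4⟩ | ⟨⟨h3, h4⟩, h5, h6⟩
  · rw [h3, h4] at hpar
    exact hne _ hpar
  · rw [h4, h6, hA h3 h5] at hpar
    exact hne _ hpar

/-- The new type is the mode sign. It does not change at falls of sign `s`, since modes `0` and `2`
have the same sign, so it switches only in `J`. -/
theorem NonRep.exists_switches_subset {Λ : Set (Fin m)} (hε : G.Parity ε)
    (h : G.NonRep (J ∪ typeSwitches τ) τ) (hJ : G.EdgesInto J Λ)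
    (hΛ : ∀ l ∈ Λ, l ∉ J → l ∈ typeFalls τ ∧ ε l = s)
    (hr : ∀ l ∈ typeRises τ, ∀ l' ∈ typeRises τ, l ∉ J → l' ∉ J → ε l = ε l') :
    ∃ σ, typeSwitches σ ⊆ J ∧ G.NonRep J σ := by
  obtain ⟨M, hM⟩ := exists_isMode ε τ J s
  have hconst : ∀ l ∉ J ∪ typeSwitches τ, M ((finRotate m).symm l) = M l := fun l hl =>
    hM.const l (fun h => hl (Or.inl h)) fun h => hl (Or.inr (typeFalls_subset h.1))
  have hsw : typeSwitches (fun u => modeSign (M u)) ⊆ J := by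
    intro l hl
    by_contra hlJ
    apply hl
    change modeSign (M ((finRotate m).symm l)) = modeSign (M l)
    by_cases h1 : l ∈ typeFalls τ ∧ ε l = s
    · obtain ⟨h2, h3⟩ := hM.fall l hlJ h1.1 h1.2
      rw [h3, modeSign, modeSign, if_neg h2, if_neg (by decide)]
    · rw [hM.const l hlJ h1]
  refine ⟨_, hsw, h.of_levels Set.subset_union_right hsw Set.subset_union_left
    (fun u => modeLevel (M u) (τ u)) ?_ ?_ ?_ ?_⟩
  · intro l hl
    rw [hconst l hl, eq_of_notMem_typeSwitches (fun h => hl (Or.inr h))]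
  · exact fun u v huv => modeSign_eq_of_modeLevel_eq _ _ _ _ huv
  · intro r x hx hx' hl
    have hmem : ∀ y, G.label y ∈ J ∨ G.label (e y) ∈ J →
        G.label y ∈ J ∨ G.label y ∈ typeFalls τ ∧ ε (G.label y) = s := by
      intro y hy
      by_cases hyJ : G.label y ∈ J
      · exact Or.inl hyJ
      · have := hJ (e y) (hy.resolve_left hyJ)
        rw [G.edge_edge] at this
        exact Or.inr (hΛ _ (this.resolve_left hyJ) hyJ)
    have h1 := (modeLevel_bounds hM (hmem x hl) r).1 hx
    rw [G.next_apply] at hx' ⊢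
    have h2 := (modeLevel_bounds hM (hmem (e x) (by rw [G.edge_edge]; exact hl.symm)) r).2 hx'
    rw [hε] at h2
    -- By parity exactly one end of the edge has signed label `r * s`. The other end satisfies the
    -- sharper bound, and the two bounds add up to a level that does not drop.
    by_cases hw : G.sign (G.vert x) * ε (G.label x) = r * s
    · have := h2.2 (by
        rw [hw]
        rcases Int.units_eq_one_or (r * s) with h | h <;> rw [h] <;> simp)
      linarith [h1.1]
    · linarith [h1.2 hw, h2.1]
  · intro r x hx hx' hl hl' h1 h2
    rw [G.next_apply] at h1
    rw [G.next_edge] at h2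
    exact (levelStep hM hl hx).not_both (levelStep hM hl' hx') (modeLevel_odd _ _)
      (modeLevel_odd _ _) (modeLevel_odd _ _) (modeLevel_odd _ _) (hε x)
      (fun ha hb => hr _ ha _ hb hl hl') h1 h2

end LabelledGraph

/-! ### Counting edges that leave a label set -/

theorem typeFalls_nonempty {m : ℕ} {τ : Fin m → ℤˣ} (h : (typeSwitches τ).Nonempty) :
    (typeFalls τ).Nonempty := by
  by_contra hF
  rw [Set.not_nonempty_iff_eq_empty] at hF
  have h1 : ∀ l, 0 ≤ ((τ l : ℤˣ) : ℤ) - (τ ((finRotate m).symm l) : ℤˣ) := by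
    intro l
    have : l ∉ typeFalls τ := by rw [hF]; exact Set.notMem_empty l
    rcases Int.units_eq_one_or (τ l) with h2 | h2 <;>
      rcases Int.units_eq_one_or (τ ((finRotate m).symm l)) with h3 | h3
    all_goals first | (rw [h2, h3]; simp; done) | exact absurd ⟨h3, h2⟩ this
  have h2 : ∑ l, (((τ l : ℤˣ) : ℤ) - (τ ((finRotate m).symm l) : ℤˣ)) = 0 := by
    rw [Finset.sum_sub_distrib, Equiv.sum_comp (finRotate m).symm fun l => ((τ l : ℤˣ) : ℤ), sub_self]
  obtain ⟨l, hl⟩ := h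
  have h3 := (Finset.sum_eq_zero_iff_of_nonneg fun l _ => h1 l).1 h2 l (Finset.mem_univ _)
  exact hl (Units.ext (by linarith))

namespace LabelledGraph

variable {X : Type*} [Fintype X] {e : Equiv.Perm X} {n m Δ : ℕ} (G : LabelledGraph e n m Δ)

/-- The endpoints with label in `L` of the edges whose other label is not in `L`. -/
def leaving (L : Set (Fin m)) : Set X := {x | G.label x ∈ L ∧ G.label (e x) ∉ L}

variable {G} {ε τ : Fin m → ℤˣ}

theorem mem_typeFalls_label {x : X} :
    G.label x ∈ typeFalls τ ↔ G.orient τ x = -1 ∧ G.orient τ (G.rot.symm x) = 1 := by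
  rcases G.orient_cases τ x with ⟨-, -, -, h4, h5⟩ | ⟨-, -, -, h4, h5⟩ <;> rw [h4, h5]
  · exact and_comm
  · rw [neg_inj, neg_eq_iff_eq_neg]
    exact Iff.rfl

theorem mem_typeRises_label {x : X} :
    G.label x ∈ typeRises τ ↔ G.orient τ x = 1 ∧ G.orient τ (G.rot.symm x) = -1 := by
  rcases G.orient_cases τ x with ⟨-, -, -, h4, h5⟩ | ⟨-, -, -, h4, h5⟩ <;> rw [h4, h5]
  · exact and_comm
  · rw [neg_inj, neg_eq_iff_eq_neg]
    exact Iff.rfl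

/-- The orientation is unchanged along both sides of an edge only if it does not join two falls or
two rises, and every edge leaving the falls or the rises has at least one unchanged side. Each
leaving endpoint is charged to such a side. -/
theorem NonRep.ncard_leaving_le (h : G.NonRep (typeSwitches τ) τ) :
    ((G.leaving (typeFalls τ)).ncard : ℤ) + (G.leaving (typeRises τ)).ncard ≤
      2 * ((n : ℤ) - G.surfaceChi) := by
  refine le_trans ?_ (h.card_unchanged_le subset_rfl)
  have hdisj : Disjoint (G.leaving (typeFalls τ)) (G.leaving (typeRises τ)) := by
    rw [Set.disjoint_left]
    intro x hx hy
    exact absurd (hx.1.1.symm.trans hy.1.1) (by decide)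
  rw [← Nat.cast_add, ← Set.ncard_union_eq hdisj, Nat.cast_le, ← Set.ncard_coe_finset]
  have hor : ∀ x ∈ G.leaving (typeFalls τ) ∪ G.leaving (typeRises τ),
      G.orient τ x = G.orient τ (G.next x) ∨ G.orient τ (e x) = G.orient τ (G.next (e x)) := by
    intro x hx
    rw [G.next_apply, G.next_edge]
    rcases hx with hx | hx
    · rw [leaving, Set.mem_ofPred_eq, mem_typeFalls_label, mem_typeFalls_label] at hx
      rw [hx.1.1, hx.1.2]
      rcases Int.units_eq_one_or (G.orient τ (e x)) with h | h
      · exact Or.inr h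
      · rcases Int.units_eq_one_or (G.orient τ (G.rot.symm (e x))) with h1 | h1
        · exact absurd ⟨h, h1⟩ hx.2
        · exact Or.inl h1.symm
    · rw [leaving, Set.mem_ofPred_eq, mem_typeRises_label, mem_typeRises_label] at hx
      rw [hx.1.1, hx.1.2]
      rcases Int.units_eq_one_or (G.orient τ (e x)) with h | h
      · rcases Int.units_eq_one_or (G.orient τ (G.rot.symm (e x))) with h1 | h1
        · exact Or.inl h1.symm
        · exact absurd ⟨h, h1⟩ hx.2
      · exact Or.inr h
  -- If both endpoints of an edge are counted, it joins a fall to a rise and both its sides are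
  -- unchanged; this makes the charging injective.
  have hand : ∀ x ∈ G.leaving (typeFalls τ) ∪ G.leaving (typeRises τ),
      e x ∈ G.leaving (typeFalls τ) ∪ G.leaving (typeRises τ) →
      G.orient τ x = G.orient τ (G.next x) := by
    intro x hx hy
    rw [G.next_apply]
    rcases hx with hx | hx
    · have hy' := (hy.resolve_left fun h => hx.2 h.1).1
      rw [(mem_typeFalls_label.1 hx.1).1, (mem_typeRises_label.1 hy').2]
    · have hy' := (hy.resolve_right fun h => hx.2 h.1).1
      rw [(mem_typeRises_label.1 hx.1).1, (mem_typeFalls_label.1 hy').2]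
  have hmem : ∀ x ∈ G.leaving (typeFalls τ) ∪ G.leaving (typeRises τ),
      G.label x ∈ typeSwitches τ := by
    rintro x (hx | hx)
    · exact typeFalls_subset hx.1
    · exact typeRises_subset hx.1
  refine Set.ncard_le_ncard_of_injOn
    (fun x => if G.orient τ x = G.orient τ (G.next x) then x else e x) ?_ ?_ (Set.toFinite _)
  · intro x hx
    split_ifs with h1
    · exact Finset.mem_coe.2 (Finset.mem_filter.2 ⟨Finset.mem_univ _, Or.inl (hmem x hx), h1⟩)
    · refine Finset.mem_coe.2 (Finset.mem_filter.2 ⟨Finset.mem_univ _, Or.inr (Or.inl ?_),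
        (hor x hx).resolve_left h1⟩)
      rw [G.edge_edge]
      exact hmem x hx
  · intro x hx y hy hxy
    beta_reduce at hxy
    split_ifs at hxy with h1 h2 h2
    · exact hxy
    · refine absurd (hand y hy ?_) h2
      rwa [← hxy]
    · refine absurd (hand x hx ?_) h1
      rwa [hxy]
    · exact e.injective hxy

/-- A leaving edge joins labels of opposite sign, hence by parity vertices of the same sign. As `τ`
is constant, both sides of the edge are unchanged, which halves the bound. -/
theorem NonRep.ncard_leaving_le_of_constant {B : Set (Fin m)} {ζ : ℤˣ} (hε : G.Parity ε)
    (h : G.NonRep B τ) (hτ : typeSwitches τ = ∅)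
    (hout : ∀ x, G.label x ∈ B → G.label (e x) ∉ B → ε (G.label (e x)) = ζ) :
    ((G.leaving {l | l ∈ B ∧ ε l = -ζ}).ncard : ℤ) ≤ (n : ℤ) - G.surfaceChi := by
  obtain ⟨L, hL⟩ : ∃ L, L = G.leaving {l | l ∈ B ∧ ε l = -ζ} := ⟨_, rfl⟩
  have h1 := h.card_unchanged_le (by rw [hτ]; exact Set.empty_subset _)
  have hζ : ∀ a : ℤˣ, a ≠ -ζ → a = ζ := by
    intro a ha
    rcases Int.units_eq_one_or a with rfl | rfl <;> rcases Int.units_eq_one_or ζ with rfl | rfl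
    all_goals first | rfl | exact absurd (by simp) ha
  have hconst : ∀ x, G.orient τ (G.rot.symm x) = G.orient τ x := fun x =>
    orient_rot_symm (K := ∅) hτ.subset (Set.notMem_empty _)
  have hτc : ∀ u v, τ u = τ v := by
    refine eq_of_finRotate fun l => ?_
    have := eq_of_notMem_typeSwitches (τ := τ) (l := finRotate m l) (by rw [hτ]; exact id)
    rw [Equiv.symm_apply_apply] at this
    exact this.symm
  have hx : ∀ x ∈ L, ε (G.label x) = -ζ ∧ ε (G.label (e x)) = ζ := by
    rw [hL]
    rintro x ⟨hx, hx'⟩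
    refine ⟨hx.2, ?_⟩
    by_cases hB : G.label (e x) ∈ B
    · exact hζ _ fun h => hx' ⟨hB, h⟩
    · exact hout x hx.1 hB
  have hsign : ∀ x ∈ L, G.sign (G.vert x) = G.sign (G.vert (e x)) := by
    intro x hxL
    have := hε x
    rw [(hx x hxL).1, (hx x hxL).2] at this
    simpa [mul_comm] using this.symm
  have hdisj : Disjoint L (e '' L) := by
    rw [Set.disjoint_left]
    rintro _ hxL ⟨y, hy, rfl⟩
    have := (hx _ hxL).1.symm.trans (hx y hy).2
    rcases Int.units_eq_one_or ζ with rfl | rfl <;> exact absurd this (by decide)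
  have h2 : (L ∪ e '' L).ncard ≤
      (Finset.univ.filter fun x => G.cut B τ x ∧ G.orient τ x = G.orient τ (G.next x)).card := by
    rw [← Set.ncard_coe_finset]
    refine Set.ncard_le_ncard ?_ (Set.toFinite _)
    rintro _ (hxL | ⟨x, hxL, rfl⟩)
    all_goals refine Finset.mem_coe.2 (Finset.mem_filter.2 ⟨Finset.mem_univ _, ?_, ?_⟩)
    · exact Or.inl (hL ▸ hxL).1.1
    · rw [G.next_apply, hconst, orient, orient, hsign _ hxL, hτc]
    · refine Or.inr (Or.inl ?_)
      rw [G.edge_edge]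
      exact (hL ▸ hxL).1.1
    · rw [G.next_edge, hconst, orient, orient, hsign _ hxL, hτc]
  rw [Set.ncard_union_eq hdisj, Set.ncard_image_of_injective _ e.injective] at h2
  rw [← hL]
  omega

/-- The set `L` is the set of falls of a fully derived type or of its negative, whichever has fewer
leaving edges; for a constant type it is the set of labels in `B` of sign `-ζ`. The last clause is
what permits recursion into a component `J` enclosed by part of `L`. -/
theorem NonRep.exists_few_leaving {B : Set (Fin m)} {ζ : ℤˣ} (hε : G.Parity ε)
    (h : G.NonRep B τ) (hτ : typeSwitches τ ⊆ B)
    (hout : ∀ x, G.label x ∈ B → G.label (e x) ∉ B → ε (G.label (e x)) = ζ)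
    (hB : ∃ b ∈ B, ε b = -ζ) :
    ∃ (s : ℤˣ) (L : Set (Fin m)), L ⊆ B ∧ L.Nonempty ∧ (∀ l ∈ L, ε l = s) ∧
      ((G.leaving L).ncard : ℤ) ≤ (n : ℤ) - G.surfaceChi ∧
      ∀ L' ⊆ L, ∀ J ⊆ B, G.EdgesInto J L' →
        ∃ σ, typeSwitches σ ⊆ J ∧ G.NonRep J σ := by
  rcases Set.eq_empty_or_nonempty (typeSwitches τ) with h0 | h0
  · refine ⟨-ζ, {l | l ∈ B ∧ ε l = -ζ}, fun l hl => hl.1, hB, fun l hl => hl.2,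
      h.ncard_leaving_le_of_constant hε h0 hout, fun L' _ J hJ _ => ⟨τ, ?_, ?_⟩⟩
    · rw [h0]; exact Set.empty_subset _
    · exact h.mono (by rw [h0]; exact Set.empty_subset _) hJ
  · have key : ∀ τ : Fin m → ℤˣ, G.Persistent B τ → (typeSwitches τ).Nonempty →
        (∀ a ∈ typeRises τ, ∀ b ∈ typeRises τ, ε a = ε b) →
        (∀ a ∈ typeFalls τ, ∀ b ∈ typeFalls τ, ε a = ε b) →
        ((G.leaving (typeFalls τ)).ncard : ℤ) ≤ (n : ℤ) - G.surfaceChi →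
        ∃ (s : ℤˣ) (L : Set (Fin m)), L ⊆ B ∧ L.Nonempty ∧ (∀ l ∈ L, ε l = s) ∧
          ((G.leaving L).ncard : ℤ) ≤ (n : ℤ) - G.surfaceChi ∧
          ∀ L' ⊆ L, ∀ J ⊆ B, G.EdgesInto J L' →
            ∃ σ, typeSwitches σ ⊆ J ∧ G.NonRep J σ := by
      intro τ hτ hne hr hf hle
      obtain ⟨l₀, hl₀⟩ := typeFalls_nonempty hne
      refine ⟨ε l₀, typeFalls τ, typeFalls_subset.trans hτ.1, ⟨l₀, hl₀⟩, fun l hl => hf l hl _ hl₀,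
        hle, fun L' hL' J hJ hE => ?_⟩
      obtain ⟨⟨τ', h1, h2⟩, -⟩ :=
        hτ.2.2 J hJ (hE.mono fun l hl _ => typeFalls_subset (hL' hl))
      exact h1.exists_switches_subset hε hE
        (fun l hl hlJ => ⟨h2.1 _ (hL' hl) hlJ, hf l (hL' hl) _ hl₀⟩)
        fun a ha b hb haJ hbJ => hr a (h2.2 _ ha haJ) b (h2.2 _ hb hbJ)
    obtain ⟨τ', h1, h2, h3, h4⟩ := (Persistent.of_nonRep hτ h).exists_constant hε h0
    have h5 := h1.2.1.ncard_leaving_le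
    by_cases h6 : ((G.leaving (typeFalls τ')).ncard : ℤ) ≤ (n : ℤ) - G.surfaceChi
    · exact key τ' h1 h2 h3 h4 h6
    · refine key (-τ') h1.neg (by rwa [typeSwitches_neg]) ?_ ?_ ?_
      · rwa [typeRises_neg]
      · rwa [typeFalls_neg]
      · rw [typeFalls_neg]
        omega

end LabelledGraph

/-! ### Complementary components of connected subgraphs -/

namespace EmbeddedGraph

variable {X : Type*} [Fintype X] {e : Equiv.Perm X} {n : ℕ} (G : EmbeddedGraph e n)

/-- The subgraph induced on a set of vertices. -/
def induced (A : Set (Fin n)) : G.Subgraph where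
  verts := A
  ends := {x | G.vert x ∈ A ∧ G.vert (e x) ∈ A}
  edge_mem := by
    rintro x ⟨h1, h2⟩
    refine ⟨h2, ?_⟩
    rwa [G.edge_edge]
  vert_mem := fun x hx => hx.1

/-- The induced subgraph on `A` is connected. -/
def ConnectedOn (A : Set (Fin n)) : Prop :=
  ∀ S : Set (Fin n), (∃ v ∈ A, v ∈ S) →
    (∀ x, G.vert x ∈ A → G.vert (e x) ∈ A → G.vert x ∈ S → G.vert (e x) ∈ S) → A ⊆ S

theorem exists_connectedOn {L : Set (Fin n)} (hL : L.Nonempty) :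
    ∃ A ⊆ L, A.Nonempty ∧ G.ConnectedOn A ∧
      ∀ x, G.vert x ∈ A → G.vert (e x) ∈ L → G.vert (e x) ∈ A := by
  obtain ⟨v, hv⟩ := hL
  let r : Fin n → Fin n → Prop := fun a b => a ∈ L ∧ b ∈ L ∧ ∃ x, G.vert x = a ∧ G.vert (e x) = b
  have hr : ∀ a b, r a b → r b a := by
    rintro a b ⟨ha, hb, x, h1, h2⟩
    exact ⟨hb, ha, e x, h2, by rw [G.edge_edge, h1]⟩
  have hsub : {w | Relation.ReflTransGen r v w} ⊆ L := by
    intro w hw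
    rcases Relation.ReflTransGen.cases_tail hw with h | ⟨u, -, hu⟩
    · rwa [h]
    · exact hu.2.1
  refine ⟨{w | Relation.ReflTransGen r v w}, hsub, ⟨v, .refl⟩, ?_, ?_⟩
  · rintro S ⟨w, hw, hwS⟩ hS
    have hstep : ∀ a b, Relation.ReflTransGen r v a → r a b → a ∈ S → b ∈ S := by
      rintro a b ha hab haS
      have hb := ha.tail hab
      obtain ⟨-, -, x, rfl, rfl⟩ := hab
      exact hS x ha hb haS
    have hvS : v ∈ S := by
      clear hsub
      induction hw with
      | refl => exact hwS
      | tail hab hbc ih => exact ih (hstep _ _ (hab.tail hbc) (hr _ _ hbc) hwS)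
    intro u hu
    induction hu with
    | refl => exact hvS
    | tail hab hbc ih => exact hstep _ _ hab hbc ih
  · intro x hx hxL
    exact hx.tail ⟨hsub hx, hxL, x, rfl, rfl⟩

namespace Subgraph

variable {G} {Λ Λ' : G.Subgraph} {x y : X}

theorem SameRegion.symm (h : Λ.SameRegion x y) : Λ.SameRegion y x := Relation.EqvGen.symm _ _ h

theorem SameRegion.trans {z : X} (h : Λ.SameRegion x y) (h' : Λ.SameRegion y z) :
    Λ.SameRegion x z := Relation.EqvGen.trans _ _ _ h h'

theorem sameRegion_rot (h : G.rot x ∉ Λ.ends) : Λ.SameRegion x (G.rot x) :=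
  Relation.EqvGen.rel _ _ (Or.inr ⟨rfl, h⟩)

theorem sameRegion_edge (h : x ∉ Λ.ends) : Λ.SameRegion x (e x) := by
  have h1 : Λ.SameRegion (e x) (G.rot.symm x) := by
    have := G.faces_boundary (e x)
    rw [G.edge_edge] at this
    exact Relation.EqvGen.rel _ _ (Or.inl this)
  have h2 : Λ.SameRegion (G.rot.symm x) x := by
    have := sameRegion_rot (Λ := Λ) (x := G.rot.symm x)
    rw [Equiv.apply_symm_apply] at this
    exact this h
  exact (h1.trans h2).symm

theorem sameRegion_of_vert (h : G.vert x ∉ Λ.verts) (hxy : G.vert x = G.vert y) :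
    Λ.SameRegion x y := by
  obtain ⟨k, rfl⟩ := ((G.vert_eq_iff x y).1 hxy).exists_nat_pow_eq
  have hk : ∀ k, G.vert ((G.rot ^ k) x) = G.vert x := fun k =>
    ((G.vert_eq_iff _ _).2 ⟨k, by simp⟩).symm
  clear hxy
  induction k with
  | zero => exact Relation.EqvGen.refl _
  | succ k ih =>
    refine ih.trans ?_
    rw [pow_succ', Equiv.Perm.mul_apply]
    refine sameRegion_rot fun h1 => h ?_
    rw [← hk (k + 1), pow_succ', Equiv.Perm.mul_apply]
    exact Λ.vert_mem _ h1

/-- A component of the complement of `Λ` all of whose edges are not in `Λ'` is contained in a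
component of the complement of `Λ'`. -/
theorem SameRegion.of_class {x₀ : X}
    (h : ∀ b, Λ.SameRegion b x₀ → b ∉ Λ.ends → b ∉ Λ'.ends) (hxy : Λ.SameRegion x y)
    (hx : Λ.SameRegion x x₀) : Λ'.SameRegion x y := by
  induction hxy with
  | rel a b hab =>
    rcases hab with hab | ⟨rfl, hb⟩
    · exact Relation.EqvGen.rel _ _ (Or.inl hab)
    · exact sameRegion_rot (h _ ((sameRegion_rot hb).symm.trans hx) hb)
  | refl a => exact Relation.EqvGen.refl _
  | symm a b hab ih => exact (ih (SameRegion.trans hab hx)).symm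
  | trans a b c hab _ ih1 ih2 => exact (ih1 hx).trans (ih2 ((SameRegion.symm hab).trans hx))

end Subgraph

variable {G} {A : Set (Fin n)}

open Subgraph

/-- The vertices not in `A` in the component of the complement of the subgraph induced on `A` that
contains the corner `x`. -/
def outerVerts (G : EmbeddedGraph e n) (A : Set (Fin n)) (x : X) : Set (Fin n) :=
  {v | v ∉ A ∧ ∃ y, G.vert y = v ∧ (G.induced A).SameRegion y x}

theorem mem_outerVerts {x y : X} :
    G.vert y ∈ G.outerVerts A x ↔ G.vert y ∉ A ∧ (G.induced A).SameRegion y x := by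
  constructor
  · rintro ⟨h1, z, hz, h2⟩
    exact ⟨h1, (sameRegion_of_vert (Λ := G.induced A) h1 hz.symm).trans h2⟩
  · rintro ⟨h1, h2⟩
    exact ⟨h1, y, rfl, h2⟩

theorem edge_mem_outerVerts {x y : X} (h : G.vert y ∈ G.outerVerts A x) (h' : G.vert (e y) ∉ A) :
    G.vert (e y) ∈ G.outerVerts A x := by
  rw [mem_outerVerts] at h ⊢
  exact ⟨h', (sameRegion_edge (Λ := G.induced A) fun hy => h'  hy.2).symm.trans h.2⟩

/-- A complementary component with no corner at `A` could be left neither through a vertex nor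
across an edge, and would be the whole connected surface. -/
theorem exists_sameRegion_mem (hA : A.Nonempty) (y : X) :
    ∃ z, G.vert z ∈ A ∧ (G.induced A).SameRegion z y := by
  by_contra hcon
  push Not at hcon
  obtain ⟨v, hv⟩ := hA
  obtain ⟨z, rfl⟩ := G.vert_surjective v
  have key : ∀ a b, Relation.EqvGen (fun a b => b = G.rot a ∨ b = e a ∨ G.faces a b) a b →
      ((G.induced A).SameRegion a y ↔ (G.induced A).SameRegion b y) := by
    intro a b hab
    induction hab with
    | rel a b hab =>
      rcases hab with rfl | rfl | hab
      · constructor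
        · intro h
          refine (sameRegion_rot fun h1 => hcon a ?_ h).symm.trans h
          have := (G.induced A).vert_mem _ h1
          rwa [G.vert_rot] at this
        · intro h
          exact (sameRegion_rot fun h1 => hcon _ ((G.induced A).vert_mem _ h1) h).trans h
      · constructor
        · intro h
          exact (sameRegion_edge fun h1 => hcon a ((G.induced A).vert_mem _ h1) h).symm.trans h
        · intro h
          exact SameRegion.trans (sameRegion_edge fun h1 => hcon (e a) (And.right h1) h) h
      · have h1 : (G.induced A).SameRegion a b := Relation.EqvGen.rel _ _ (Or.inl hab)
        exact ⟨fun h => h1.symm.trans h, fun h => h1.trans h⟩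
    | refl a => exact Iff.rfl
    | symm a b _ ih => exact ih.symm
    | trans a b c _ _ ih1 ih2 => exact ih1.trans ih2
  exact hcon z hv ((key z y (G.connected z y)).2 (Relation.EqvGen.refl _))

/-- Everything outside one complementary component of `A` is joined to `A` without meeting that
component, and `A` itself is connected. A subgraph inside the component therefore does not separate
the vertices outside it. -/
theorem sameRegion_of_notMem_outerVerts (hA : A.Nonempty) (hc : G.ConnectedOn A) {x₀ : X}
    {A' : Set (Fin n)} (hA' : A' ⊆ G.outerVerts A x₀) {x y : X}
    (hx : G.vert x ∉ G.outerVerts A x₀) (hy : G.vert y ∉ G.outerVerts A x₀) :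
    (G.induced A').SameRegion x y := by
  have hAA' : ∀ v ∈ A, v ∉ A' := fun v hv hv' => (hA' hv').1 hv
  have h1 : ∀ x, G.vert x ∉ G.outerVerts A x₀ → ∃ z, G.vert z ∈ A ∧
      (G.induced A').SameRegion z x := by
    intro x hx
    by_cases hxA : G.vert x ∈ A
    · exact ⟨x, hxA, Relation.EqvGen.refl _⟩
    · obtain ⟨z, hz, hzx⟩ := exists_sameRegion_mem (G := G) hA x
      refine ⟨z, hz, hzx.of_class (x₀ := x) (fun b hb _ hb' => hx ?_) hzx⟩
      have := (mem_outerVerts.1 (hA' hb'.1)).2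
      exact mem_outerVerts.2 ⟨hxA, hb.symm.trans this⟩
  obtain ⟨z, hz, hzx⟩ := h1 x hx
  obtain ⟨w, hw, hwy⟩ := h1 y hy
  refine hzx.symm.trans (SameRegion.trans ?_ hwy)
  have h2 := hc {v | ∀ y, G.vert y = v → (G.induced A').SameRegion z y}
    ⟨_, hz, fun y hy => sameRegion_of_vert (hAA' _ hz) hy.symm⟩ (by
      intro a ha hea hza y hy
      refine (hza a rfl).trans ((sameRegion_edge fun h => ?_).trans
        (sameRegion_of_vert (hAA' _ hea) hy.symm))
      exact hAA' _ ha h.1)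
  exact h2 hw w rfl

theorem induced_compl_outerVerts_isGreat (x₀ : X) : (G.induced (G.outerVerts A x₀)ᶜ).IsGreat := by
  intro x y hx hy
  have hx' := (mem_outerVerts.1 (not_not.1 hx)).2
  have hy' := (mem_outerVerts.1 (not_not.1 hy)).2
  refine (hx'.trans hy'.symm).of_class (x₀ := x₀) (fun b hb hbA hb' => ?_) hx'
  by_cases h1 : G.vert b ∈ A
  · have h2 : G.vert (e b) ∉ A := fun h => hbA ⟨h1, h⟩
    exact hb'.2 (mem_outerVerts.2 ⟨h2, (sameRegion_edge hbA).symm.trans hb⟩)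
  · exact hb'.1 (mem_outerVerts.2 ⟨h1, hb⟩)

end EmbeddedGraph

/-! ### Innermost argument producing the great web -/

namespace IntersectionGraphs

variable {X : Type*} [Fintype X] {e : Equiv.Perm X} {p q Δ : ℕ}
  (G : IntersectionGraphs e p q Δ)

theorem parity_GP : G.GP.Parity G.GQ.sign := by
  intro x
  have := G.parity x
  rw [G.label_GP]
  revert this
  generalize G.GP.sign (G.GP.vert x) = a
  generalize G.GP.sign (G.GP.vert (e x)) = b
  generalize G.GQ.sign (G.GQ.vert x) = c
  generalize G.GQ.sign (G.GQ.vert (e x)) = d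
  intro h
  rcases Int.units_eq_one_or a with rfl | rfl <;> rcases Int.units_eq_one_or b with rfl | rfl <;>
    rcases Int.units_eq_one_or c with rfl | rfl <;> rcases Int.units_eq_one_or d with rfl | rfl <;>
    simp at h ⊢

theorem isGreatWeb_induced {A : Set (Fin q)} {k : ℤ} (hA : A.Nonempty)
    (hs : ∀ v ∈ A, ∀ w ∈ A, G.GQ.sign v = G.GQ.sign w)
    (hk : ((G.GP.leaving A).ncard : ℤ) ≤ k) (hgreat : (G.GQ.induced A).IsGreat) :
    G.GQ.IsGreatWeb k (G.GQ.induced A) := by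
  refine ⟨⟨hA, hs, le_trans (Nat.cast_le.2 (Set.ncard_le_ncard ?_ (Set.toFinite _))) hk⟩, hgreat⟩
  rintro x ⟨h1, h2⟩
  rw [LabelledGraph.leaving, G.label_GP]
  exact ⟨h1, fun h => h2 ⟨h1, h⟩⟩

theorem exists_isGreatWeb_of_nonRep (k : ℕ) : ∀ {B : Set (Fin q)} {τ : Fin q → ℤˣ} {ζ : ℤˣ},
    B.ncard = k → G.GP.NonRep B τ → typeSwitches τ ⊆ B →
    (∀ x, G.GP.label x ∈ B → G.GP.label (e x) ∉ B → G.GQ.sign (G.GP.label (e x)) = ζ) →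
    (∃ b ∈ B, G.GQ.sign b = -ζ) →
    (∀ A ⊆ B, ∀ x y, G.GQ.vert x ∉ B → G.GQ.vert y ∉ B → (G.GQ.induced A).SameRegion x y) →
    ∃ Λ : G.GQ.Subgraph, G.GQ.IsGreatWeb ((p : ℤ) - G.GP.surfaceChi) Λ := by
  induction k using Nat.strong_induction_on with
  | _ k ih =>
    intro B τ ζ hBk h hτ hout hB hreg
    obtain ⟨s, L, hLB, hLne, hLs, hLk, hL⟩ := h.exists_few_leaving G.parity_GP hτ hout hB
    obtain ⟨A, hAL, hAne, hAc, hAL'⟩ := G.GQ.exists_connectedOn hLne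
    have hAk : ((G.GP.leaving A).ncard : ℤ) ≤ (p : ℤ) - G.GP.surfaceChi := by
      refine le_trans (Nat.cast_le.2 (Set.ncard_le_ncard ?_ (Set.toFinite _))) hLk
      rintro x ⟨h1, h2⟩
      refine ⟨hAL h1, fun h3 => h2 ?_⟩
      rw [G.label_GP] at h1 h3 ⊢
      exact hAL' x h1 h3
    -- The outer component of the complement of `A` is the one containing all vertices not in `B`.
    -- If there are none, any corner may serve.
    have hx₀ : ∃ x₀, ∀ y, G.GQ.vert y ∉ B → G.GQ.vert y ∈ G.GQ.outerVerts A x₀ := by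
      by_cases hne : ∃ x, G.GQ.vert x ∉ B
      · obtain ⟨x, hx⟩ := hne
        exact ⟨x, fun y hy => EmbeddedGraph.mem_outerVerts.2
          ⟨fun h1 => hy (hLB (hAL h1)), hreg A (hAL.trans hLB) y x hy hx⟩⟩
      · obtain ⟨x, -⟩ := G.GQ.vert_surjective hAne.some
        exact ⟨x, fun y hy => absurd ⟨y, hy⟩ hne⟩
    obtain ⟨x₀, hx₀⟩ := hx₀
    by_cases hinner : ∃ y, G.GQ.vert y ∉ A ∧ G.GQ.vert y ∉ G.GQ.outerVerts A x₀ ∧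
        G.GQ.sign (G.GQ.vert y) = -s
    -- The induction continues in the component of `y`. Edges leaving it end in `A`, so their outer
    -- labels have sign `s`, while `y` has sign `-s`; it misses the nonempty set `A` and so is
    -- strictly smaller than `B`.
    · obtain ⟨y, hyA, hyx, hys⟩ := hinner
      have hJB : G.GQ.outerVerts A y ⊆ B := by
        rintro v hv
        obtain ⟨z, rfl⟩ := G.GQ.vert_surjective v
        by_contra hzB
        have h1 := EmbeddedGraph.mem_outerVerts.1 hv
        have h2 := EmbeddedGraph.mem_outerVerts.1 (hx₀ z hzB)
        exact hyx (EmbeddedGraph.mem_outerVerts.2 ⟨hyA, h1.2.symm.trans h2.2⟩)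
      have hE : G.GP.EdgesInto (G.GQ.outerVerts A y) A := by
        intro x hx
        rw [G.label_GP] at hx ⊢
        by_cases h1 : G.GQ.vert (e x) ∈ A
        · exact Or.inr h1
        · exact Or.inl (EmbeddedGraph.edge_mem_outerVerts hx h1)
      obtain ⟨σ, hσ, hσ'⟩ := hL A hAL _ hJB hE
      refine ih _ ?_ rfl hσ' hσ (ζ := s) ?_ ?_ ?_
      · rw [← hBk]
        refine Set.ncard_lt_ncard ⟨hJB, fun h1 => ?_⟩ (Set.toFinite _)
        obtain ⟨v, hv⟩ := hAne
        exact (h1 (hLB (hAL hv))).1 hv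
      · intro x hx hx'
        exact hLs _ (hAL ((hE x hx).resolve_left hx'))
      · exact ⟨_, EmbeddedGraph.mem_outerVerts.2 ⟨hyA, Relation.EqvGen.refl _⟩, hys⟩
      · intro A' hA' x z hx hz
        exact EmbeddedGraph.sameRegion_of_notMem_outerVerts hAne hAc hA' hx hz
    -- All enclosed vertices have sign `s`, so they are added to `A`. No edge joins an enclosed
    -- vertex to an outer one, so no new leaving endpoints arise.
    · have hsub : A ⊆ (G.GQ.outerVerts A x₀)ᶜ := fun v hv hv' => hv'.1 hv
      have hs : ∀ v ∈ (G.GQ.outerVerts A x₀)ᶜ, G.GQ.sign v = s := by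
        intro v hv
        by_cases hvA : v ∈ A
        · exact hLs v (hAL hvA)
        · obtain ⟨y, rfl⟩ := G.GQ.vert_surjective v
          by_contra hne
          refine hinner ⟨y, hvA, hv, ?_⟩
          revert hne
          generalize G.GQ.sign (G.GQ.vert y) = a
          intro hne
          rcases Int.units_eq_one_or a with rfl | rfl <;>
            rcases Int.units_eq_one_or s with rfl | rfl <;> simp at hne ⊢
      refine ⟨_, G.isGreatWeb_induced (hAne.mono hsub) (fun v hv w hw => by rw [hs v hv, hs w hw])
        (le_trans (Nat.cast_le.2 (Set.ncard_le_ncard ?_ (Set.toFinite _))) hAk)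
        (EmbeddedGraph.induced_compl_outerVerts_isGreat x₀)⟩
      rintro x ⟨h1, h2⟩
      rw [LabelledGraph.leaving, G.label_GP]
      rw [G.label_GP] at h1 h2
      rw [Set.mem_compl_iff, not_not] at h2
      refine ⟨?_, h2.1⟩
      by_contra hxA
      refine h1 ?_
      have := EmbeddedGraph.edge_mem_outerVerts (y := e x) h2 (by rwa [G.GQ.edge_edge])
      rwa [G.GQ.edge_edge] at this

end IntersectionGraphs

end Classical

theorem theorem5p6 {X : Type*} [Fintype X] {e : Equiv.Perm X} {p q Δ : ℕ}
    (G : IntersectionGraphs e p q Δ) (hΔ : 1 ≤ Δ)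
    (hP : (Δ : ℚ) > 1 - (G.GP.surfaceChi : ℚ) / (p : ℚ))
    (hQ : G.GQ.IsSphere) :
    G.GP.RepresentsAllTypes ∨
      ∃ Λ : G.GQ.Subgraph, G.GQ.IsGreatWeb ((p : ℤ) - G.GP.surfaceChi) Λ := by
  by_cases hrep : G.GP.RepresentsAllTypes
  · exact Or.inl hrep
  · rw [LabelledGraph.RepresentsAllTypes] at hrep
    push Not at hrep
    obtain ⟨τ, hτ⟩ := hrep
    -- The induction starts with all labels, where the conditions on labels outside `B` are vacuous.
    -- `ζ` is chosen so that the first vertex has sign `-ζ`.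
    refine Or.inr (G.exists_isGreatWeb_of_nonRep _ rfl
      (LabelledGraph.nonRep_univ G.noTrivialLoops_GP (not_exists.2 hτ)) (Set.subset_univ _)
      (ζ := -G.GQ.sign ⟨0, G.q_pos⟩) (fun x _ h => absurd (Set.mem_univ _) h)
      ⟨_, Set.mem_univ _, (neg_neg _).symm⟩ fun A _ x _ h => absurd (Set.mem_univ _) h)
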